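/- Let $L\in\mathbb{N}$. A bundle is a point of $\mathbb{R}_+^L$; write $\mathbf q>\mathbf q'$ if $\mathbf q\ge\mathbf q'$ coordinatewise and $\mathbf q\ne\mathbf q'$, and $B(\mathbf p,m)=\{\mathbf q\in\mathbb{R}_+^L:\mathbf p\cdot\mathbf q\le m\}$. A purchase dataset with $T$ observations is $D=(\mathbf q^t,\mathbf p^t)_{t\le T}\in((\mathbb{R}_+^L\setminus\{\mathbf 0\})\times\mathbb{R}_{++}^L)^T$. A utility function $U:\mathbb{R}_+^L\to\mathbb{R}$ rationalizes $D$ if, for all $t$, $U(\mathbf q^t)\ge U(\mathbf q)$ for all $\mathbf q\in B(\mathbf p^t,\mathbf p^t\cdot\mathbf q^t)$; for $\mathbf e\in[0,1]^T$, $D$ is $\mathbf e$-rationalized by $U$ if, for all $t$, $U(\mathbf q^t)\ge U(\mathbf q)$ for all $\mathbf q\in B(\mathbf p^t,e_t\,\mathbf p^t\cdot\mathbf q^t)$, and for a scalar $e\in[0,1]$ it is $e$-rationalized if this holds with $e_t=e$ for all $t$. Let $\mathcal U_{WB}$ be the set of continuous $U$ that are increasing ($\mathbf q>\mathbf q'$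 implies $U(\mathbf q)>U(\mathbf q')$). $D$ satisfies GARP if there are no $t_1,\dots,t_K$ with $\mathbf p^{t_k}\cdot\mathbf q^{t_k}\ge\mathbf p^{t_k}\cdot\mathbf q^{t_{k+1}}$ for all $k<K$ and $\mathbf p^{t_K}\cdot\mathbf q^{t_K}>\mathbf p^{t_K}\cdot\mathbf q^{t_1}$. For each $T$ let $f:[0,1]^T\to\mathbb{R}_+$ be continuous and decreasing ($\mathbf e>\mathbf e'$ implies $f(\mathbf e)<f(\mathbf e')$) with $f(\mathbf e)=0$ if and only if $e_1=\dots=e_T=1$, and for each dataset $D$ and each $t\le T$ let $\mathbf W_D^t$ be a positive definite $L\times L$ matrix that is continuous as a function of $D$ for each fixed $T$. With $\mu$ Lebesgue measure, define the loss functions - Afriat: $A(U;D)=1-\sup\{e\in[0,1]: D\text{ is }e\text{-rationalized by }U\}$; - Varian: $V(U;D)=\inf\{f(\mathbf e): D\text{ is }\mathbf e\text{-rationalized by }U\}$; - Swaps: $S(U;D)=\sum_{t=1}^T\mu\{\mathbf q\in B(\mathbf p^t,\mathbf p^t\cdot\mathbf q^t):U(\mathbf q)>U(\mathbf q^t)\}$;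 - LS: $\mathrm{LS}(U;D)=\inf\sum_{t=1}^T(\mathbf q^t-\tilde{\mathbf q}^t)'\mathbf W_D^t(\mathbf q^t-\tilde{\mathbf q}^t)$, the infimum being over the datasets $(\tilde{\mathbf q}^t,\mathbf p^t)_{t\le T}$ that are rationalized by $U$ and satisfy $\tilde{\mathbf q}^t\in B(\mathbf p^t,\mathbf p^t\cdot\mathbf q^t)$ for all $t$. Then each $Q\in\{A,V,S,\mathrm{LS}\}$ is accurate for $\mathcal U_{WB}$: for all $U\in\mathcal U_{WB}$ and all datasets $D$, $Q(U;D)=0$ if and only if $U$ rationalizes $D$. If $L\ge2$, then none of them is minimizable for $\mathcal U_{WB}$: for each $Q$ there is a dataset $D$ with $\operatorname{argmin}_{U\in\mathcal U_{WB}}Q(U;D)=\emptyset$. More specifically: 1. If $Q\in\{V,S,\mathrm{LS}\}$ and $D$ does not satisfy GARP, then $\operatorname{argmin}_{U\in\mathcal U_{WB}}Q(U;D)=\emptyset$. 2. For every $T\in\mathbb{N}$, let $\mathcal D\subseteq((\mathbb{R}_+^L\setminus\{\mathbf 0\})\times\mathbb{R}_{++}^L)^T$ be the set of $T$-observation datasets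 that do not satisfy GARP, with the subspace topology. Then $\{D\in\mathcal D:\operatorname{argmin}_{U\in\mathcal U_{WB}}A(U;D)\ne\emptyset\}$ is nowhere dense in $\mathcal D$, i.e. its closure in $\mathcal D$ has empty interior in $\mathcal D$. -/

import Mathlib

open scoped Matrix

noncomputable section

namespace RevealedPreference

/-- Consumption bundles of `L` goods: the nonnegative orthant `ℝ₊ᴸ`, with the coordinatewise
order (so `q' < q` means `q' ≤ q` and `q' ≠ q`) and the subspace topology. -/
abbrev Bundle (L : ℕ) : Type := {q : Fin L → ℝ // 0 ≤ q}

/-- Price vectors: the strictly positive orthant `ℝ₊₊ᴸ`. -/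
abbrev Price (L : ℕ) : Type := {p : Fin L → ℝ // ∀ i, 0 < p i}

/-- Purchase datasets with `T` observations: the space `((ℝ₊ᴸ \ {0}) × ℝ₊₊ᴸ)ᵀ` with its usual
topology. -/
abbrev Dataset (L T : ℕ) : Type := Fin T → {q : Bundle L // q.1 ≠ 0} × Price L

/-- Utility functions on `ℝ₊ᴸ`. -/
abbrev Utility (L : ℕ) : Type := Bundle L → ℝ

variable {L T : ℕ}

/-- The bundle bought at observation `t`. -/
def Dataset.bundle (D : Dataset L T) (t : Fin T) : Bundle L := (D t).1.1

/-- The price vector at observation `t`. -/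
def Dataset.price (D : Dataset L T) (t : Fin T) : Price L := (D t).2

/-- The cost `p · q` of a bundle. -/
def cost (p : Price L) (q : Bundle L) : ℝ := p.1 ⬝ᵥ q.1

/-- The linear budget set `B(p, m)`. -/
def budget (p : Price L) (m : ℝ) : Set (Bundle L) := {q | cost p q ≤ m}

/-- The expenditure `pᵗ · qᵗ` at observation `t`. -/
def Dataset.expenditure (D : Dataset L T) (t : Fin T) : ℝ := cost (D.price t) (D.bundle t)

/-- `U` rationalizes `D`. -/
def Rationalizes (U : Utility L) (D : Dataset L T) : Prop :=
  ∀ t, ∀ q ∈ budget (D.price t) (D.expenditure t), U q ≤ U (D.bundle t)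

/-- `D` is `e`-rationalized by `U`, for a vector `e` of efficiency levels. -/
def EffRationalizes (U : Utility L) (D : Dataset L T) (e : Fin T → ℝ) : Prop :=
  ∀ t, ∀ q ∈ budget (D.price t) (e t * D.expenditure t), U q ≤ U (D.bundle t)

/-- The family of well-behaved (continuous and increasing) utility functions. -/
def wellBehaved (L : ℕ) : Set (Utility L) := {U | Continuous U ∧ StrictMono U}

/-- Direct revealed preference, `qᵗ R qˢ`. -/
def DirectRP (D : Dataset L T) (t s : Fin T) : Prop :=
  cost (D.price t) (D.bundle s) ≤ D.expenditure t

/-- Strict direct revealed preference, `qᵗ P qˢ`. -/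
def StrictRP (D : Dataset L T) (t s : Fin T) : Prop :=
  cost (D.price t) (D.bundle s) < D.expenditure t

/-- The generalized axiom of revealed preference: along a chain
`qᵗ = q^{t₁} R q^{t₂} R ⋯ R q^{t_K} = qˢ` it is never the case that `qˢ P qᵗ`. -/
def GARP (D : Dataset L T) : Prop :=
  ∀ t s, Relation.ReflTransGen (DirectRP D) t s → ¬ StrictRP D s t

/-- A map `Q(U; D)` of utility functions and datasets (with any number of observations). -/
abbrev Loss (L : ℕ) : Type := ∀ T : ℕ, Utility L → Dataset L T → ℝ

/-- The minimizers over `𝒰` of `Q(·; D)`. -/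
def argmin (𝒰 : Set (Utility L)) (Q : Loss L) (D : Dataset L T) : Set (Utility L) :=
  {U | U ∈ 𝒰 ∧ ∀ U' ∈ 𝒰, Q T U D ≤ Q T U' D}

/-- `Q` is accurate for `𝒰`. -/
def Accurate (𝒰 : Set (Utility L)) (Q : Loss L) : Prop :=
  ∀ U ∈ 𝒰, ∀ (T : ℕ) (D : Dataset L T), Q T U D = 0 ↔ Rationalizes U D

/-- `Q` is minimizable for `𝒰`. -/
def Minimizable (𝒰 : Set (Utility L)) (Q : Loss L) : Prop :=
  ∀ (T : ℕ) (D : Dataset L T), (argmin 𝒰 Q D).Nonempty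

/-- The Afriat loss function. -/
def afriatLoss (L : ℕ) : Loss L := fun _ U D =>
  1 - sSup {e : ℝ | e ∈ Set.Icc (0 : ℝ) 1 ∧ EffRationalizes U D (fun _ => e)}

/-- The admissible aggregators in the Varian loss: continuous, decreasing (in the order where
`e' < e` means `e' ≤ e` and `e' ≠ e`), nonnegative functions on `[0,1]ᵀ` which vanish exactly at
`(1, …, 1)`. -/
structure IsVarianAggregator (f : (Fin T → unitInterval) → ℝ) : Prop where
  continuous : Continuous f
  strictAnti : StrictAnti f
  nonneg : ∀ e, 0 ≤ f e
  eq_zero_iff : ∀ e, f e = 0 ↔ ∀ t, e t = 1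

/-- The Varian loss function with aggregators `f`. For increasing `U` the infimum is over a
nonempty set, since `e = 0` is admissible. -/
def varianLoss (f : ∀ T : ℕ, (Fin T → unitInterval) → ℝ) : Loss L := fun T U D =>
  sInf {r : ℝ | ∃ e : Fin T → unitInterval,
    EffRationalizes U D (fun t => (e t : ℝ)) ∧ r = f T e}

/-- The Swaps loss function: total Lebesgue measure of the affordable strict upper contour sets,
which are subsets of (bounded) budget sets. -/
def swapsLoss (L : ℕ) : Loss L := fun _ U D =>
  ∑ t, (MeasureTheory.volume ((fun q : Bundle L => (q.1 : Fin L → ℝ)) ''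
    {q | q ∈ budget (D.price t) (D.expenditure t) ∧ U (D.bundle t) < U q})).toReal

/-- The admissible weights in the least squares loss: positive definite matrices which depend
continuously on the dataset. -/
structure IsLSWeight (W : Dataset L T → Fin T → Matrix (Fin L) (Fin L) ℝ) : Prop where
  posDef : ∀ D t, (W D t).PosDef
  continuous : ∀ t, Continuous fun D => W D t

/-- The nonlinear least squares loss function with weights `W`: the infimum runs over the datasets
`D'` with the prices of `D` that `U` rationalizes and whose bundles lie in the budget sets of `D`.
For well-behaved `U` there are such `D'` (choose maximizers of `U` in the budget sets). -/
def lsLoss (W : ∀ T : ℕ, Dataset L T → Fin T → Matrix (Fin L) (Fin L) ℝ) : Loss L := fun T U D =>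
  sInf {r : ℝ | ∃ D' : Dataset L T,
    (∀ t, D'.price t = D.price t) ∧
    Rationalizes U D' ∧
    (∀ t, D'.bundle t ∈ budget (D.price t) (D.expenditure t)) ∧
    r = ∑ t, ((D.bundle t).1 - (D'.bundle t).1) ⬝ᵥ
      (W T D t *ᵥ ((D.bundle t).1 - (D'.bundle t).1))}

end RevealedPreference

end

/-! Accuracy is a matter of attainment. The efficiency vectors at which a well-behaved `U` works
form a compact set, and the tuples optimal for `U` do too, so a zero Afriat, Varian or least squares
loss is realized by exact rationalization. For Swaps, a violation produces a nonempty open set of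
better affordable bundles, which has positive measure.

If GARP fails, no well-behaved `U` rationalizes `D`, and it suffices to improve on each `U`. The
main tool is `exists_effRationalizes_of_rank`: a strict ranking of observations that decreases along
revealed preference yields a utility. Ties in `U` are what limit a given utility, and breaking them
by a secondary ranking creates slack. For Varian, one efficiency `e t < 1` is raised while the
others shrink slightly. For least squares, one bundle of a closest optimal tuple moves towards the
data and a small perturbation separates ties. For Swaps, `U` is instead lowered near a bundle
indifferent to an observed one (`exists_lowering`).

The Afriat index has only one level to raise, so ties at several observations can block it. For
generic data at most one observation has a tie at the critical level. Genericity is open, and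
`exists_tendsto_generic` shows that it is dense among GARP violations. -/

namespace RevealedPreference

variable {L T : ℕ}

/-! ### Costs, dilations and translations of bundles -/

section Cost

lemma continuous_cost (p : Price L) : Continuous (cost p) := by
  show Continuous fun q : Bundle L => ∑ i, p.1 i * q.1 i
  exact continuous_finsetSum _ fun i _ =>
    continuous_const.mul ((continuous_apply i).comp continuous_subtype_val)

lemma continuous_cost_dataset (s t : Fin T) :
    Continuous fun D : Dataset L T => cost (D.price s) (D.bundle t) := by
  show Continuous fun D : Dataset L T => ∑ i, (D s).2.1 i * (D t).1.1.1 i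
  refine continuous_finsetSum _ fun i _ => Continuous.mul ?_ ?_
  · exact (continuous_apply i).comp
      (continuous_subtype_val.comp (continuous_snd.comp (continuous_apply s)))
  · exact (continuous_apply i).comp (continuous_subtype_val.comp
      (continuous_subtype_val.comp (continuous_fst.comp (continuous_apply t))))

lemma cost_strictMono (p : Price L) : StrictMono (cost p) := by
  intro q q' h
  obtain ⟨hle, i, hi⟩ := Pi.lt_def.1 (show q.1 < q'.1 from h)
  exact Finset.sum_lt_sum (fun j _ => mul_le_mul_of_nonneg_left (hle j) (p.2 j).le)
    ⟨i, Finset.mem_univ i, mul_lt_mul_of_pos_left hi (p.2 i)⟩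

lemma zero_lt_bundle {q : Bundle L} (hq : q.1 ≠ 0) : (⟨0, le_rfl⟩ : Bundle L) < q :=
  show (0 : Fin L → ℝ) < q.1 from lt_of_le_of_ne q.2 hq.symm

lemma cost_zero (p : Price L) : cost p ⟨0, le_rfl⟩ = 0 := by
  simp [cost]

lemma cost_pos (p : Price L) {q : Bundle L} (hq : q.1 ≠ 0) : 0 < cost p q := by
  simpa [cost_zero] using cost_strictMono p (zero_lt_bundle hq)

lemma cost_nonneg (p : Price L) (q : Bundle L) : 0 ≤ cost p q := by
  have := (cost_strictMono p).monotone (show (⟨0, le_rfl⟩ : Bundle L) ≤ q from q.2)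
  rwa [cost_zero] at this

lemma eq_zero_of_cost_nonpos (p : Price L) {q : Bundle L} (h : cost p q ≤ 0) :
    q = ⟨0, le_rfl⟩ := by
  by_contra hq
  exact absurd (cost_pos p (fun h0 => hq (Subtype.ext h0))) h.not_gt

lemma Dataset.bundle_ne_zero (D : Dataset L T) (t : Fin T) : (D.bundle t).1 ≠ 0 := (D t).1.2

lemma Dataset.cost_pos (D : Dataset L T) (s t : Fin T) : 0 < cost (D.price s) (D.bundle t) :=
  RevealedPreference.cost_pos _ (D.bundle_ne_zero t)

lemma Dataset.expenditure_pos (D : Dataset L T) (t : Fin T) : 0 < D.expenditure t :=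
  D.cost_pos t t

lemma Dataset.nonempty_goods (D : Dataset L T) (t : Fin T) : Nonempty (Fin L) := by
  by_contra h
  rw [not_nonempty_iff] at h
  exact D.bundle_ne_zero t (Subsingleton.elim _ _)

/-- Dilation of a bundle by `|c|`. -/
def dilate (c : ℝ) (q : Bundle L) : Bundle L := ⟨|c| • q.1, smul_nonneg (abs_nonneg c) q.2⟩

lemma cost_dilate (p : Price L) (c : ℝ) (q : Bundle L) : cost p (dilate c q) = |c| * cost p q := by
  simp [cost, dilate, dotProduct_smul]

lemma dilate_one (q : Bundle L) : dilate 1 q = q := Subtype.ext (by simp [dilate])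

lemma dilate_zero (q : Bundle L) : dilate 0 q = ⟨0, le_rfl⟩ := Subtype.ext (by simp [dilate])

lemma continuous_dilate (q : Bundle L) : Continuous fun c => dilate c q := by
  unfold dilate
  fun_prop

/-- The bundle obtained by adding `|c|` units of every good. -/
def translate (c : ℝ) (q : Bundle L) : Bundle L :=
  ⟨fun i => q.1 i + |c|, fun i => add_nonneg (q.2 i) (abs_nonneg c)⟩

lemma translate_zero (q : Bundle L) : translate 0 q = q := Subtype.ext (by simp [translate])

lemma continuous_translate (q : Bundle L) : Continuous fun c => translate c q := by
  unfold translate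
  fun_prop

lemma lt_translate [Nonempty (Fin L)] {c : ℝ} (hc : 0 < c) (q : Bundle L) :
    q < translate c q := by
  show q.1 < _
  refine Pi.lt_def.2 ⟨fun i => ?_, ⟨Classical.arbitrary _, ?_⟩⟩ <;> simp [translate, hc.ne']

lemma exists_translate_mem {s : Set (Bundle L)} (hs : IsOpen s) {q : Bundle L} (hq : q ∈ s) :
    ∃ c > 0, translate c q ∈ s := by
  have h : ∀ᶠ c in nhds (0 : ℝ), translate c q ∈ s :=
    (continuous_translate q).continuousAt.eventually_mem
      (by rw [translate_zero]; exact hs.mem_nhds hq)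
  obtain ⟨c, hc, hc0⟩ := ((h.filter_mono nhdsWithin_le_nhds).and
    (self_mem_nhdsWithin : Set.Ioi (0 : ℝ) ∈ nhdsWithin 0 (Set.Ioi 0))).exists
  exact ⟨c, hc0, hc⟩

lemma isCompact_budget (p : Price L) (m : ℝ) : IsCompact (budget p m) := by
  have hK : IsCompact ((Subtype.val : Bundle L → Fin L → ℝ) ⁻¹'
      Set.Icc 0 (fun i => m / p.1 i)) :=
    (isClosed_Ici.isClosedEmbedding_subtypeVal (X := Fin L → ℝ)).isCompact_preimage isCompact_Icc
  refine hK.of_isClosed_subset (isClosed_le (continuous_cost p) continuous_const) ?_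
  refine fun q hq => ⟨q.2, fun i => ?_⟩
  rw [le_div_iff₀ (p.2 i), mul_comm]
  exact (Finset.single_le_sum (f := fun j => p.1 j * q.1 j)
    (fun j _ => mul_nonneg (p.2 j).le (q.2 j)) (Finset.mem_univ i)).trans hq

end Cost

/-! ### Well-behaved utilities and efficiency levels -/

section WellBehaved

variable {U : Utility L}

lemma apply_lt_of_cost_lt [Nonempty (Fin L)] (hU : U ∈ wellBehaved L) {p : Price L} {m c : ℝ}
    (h : ∀ q, cost p q < m → U q ≤ c) {q : Bundle L} (hq : cost p q < m) : U q < c := by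
  obtain ⟨η, hη, hm⟩ := exists_translate_mem (isOpen_lt (continuous_cost p) continuous_const)
    (show q ∈ {q | cost p q < m} from hq)
  exact (hU.2 (lt_translate hη q)).trans_le (h _ hm)

lemma apply_le_of_cost_le (hU : Continuous U) {p : Price L} {m c : ℝ} (hm : 0 < m)
    (h : ∀ q, cost p q < m → U q ≤ c) {q : Bundle L} (hq : cost p q ≤ m) : U q ≤ c := by
  have hlim : Filter.Tendsto (fun x => U (dilate x q)) (nhdsWithin 1 (Set.Ioo 0 1)) (nhds (U q)) := by
    have := (hU.comp (continuous_dilate q)).tendsto 1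
    simp only [Function.comp_def, dilate_one] at this
    exact this.mono_left nhdsWithin_le_nhds
  have : (nhdsWithin (1 : ℝ) (Set.Ioo 0 1)).NeBot := by
    rw [← mem_closure_iff_nhdsWithin_neBot, closure_Ioo zero_ne_one]
    simp
  refine le_of_tendsto hlim ?_
  filter_upwards [self_mem_nhdsWithin] with x hx
  refine h _ ?_
  rw [cost_dilate, abs_of_pos hx.1]
  nlinarith [hx.1, hx.2, cost_nonneg p q]

lemma rationalizes_iff_eff_one {D : Dataset L T} :
    Rationalizes U D ↔ EffRationalizes U D fun _ => 1 := by
  simp [Rationalizes, EffRationalizes]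

/-- Strict budget inequalities make the condition closed in `e`, so optimal efficiency levels are
attained. A zero budget contains only the zero bundle and is treated separately, since dilation
cannot lower its cost. -/
lemma effRationalizes_iff (hU : U ∈ wellBehaved L) {D : Dataset L T} {e : Fin T → ℝ}
    (he : ∀ t, 0 ≤ e t) : EffRationalizes U D e ↔
      ∀ t q, cost (D.price t) q < e t * D.expenditure t → U q ≤ U (D.bundle t) := by
  refine ⟨fun h t q hq => h t q hq.le, fun h t q hq => ?_⟩
  rcases (mul_nonneg (he t) (D.expenditure_pos t).le).eq_or_lt with h0 | h0
  · rw [eq_zero_of_cost_nonpos _ (hq.trans h0.ge)]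
    exact (hU.2 (zero_lt_bundle (D.bundle_ne_zero t))).le
  · exact apply_le_of_cost_le hU.1 h0 (h t) hq

lemma isClosed_effRationalizes {X : Type*} [TopologicalSpace X] (hU : U ∈ wellBehaved L)
    (D : Dataset L T) {e : X → Fin T → ℝ} (he : Continuous e) (he0 : ∀ x t, 0 ≤ e x t) :
    IsClosed {x | EffRationalizes U D (e x)} := by
  simp only [fun x => effRationalizes_iff (D := D) hU (he0 x), ← not_lt (b := U _), Set.ofPred_forall]
  refine isClosed_iInter fun t => isClosed_iInter fun q => ?_
  by_cases h : U (D.bundle t) < U q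
  · simp only [h, not_true, imp_false, not_lt]
    exact isClosed_le (by fun_prop) continuous_const
  · simp [h]

lemma EffRationalizes.apply_le {D : Dataset L T} {e : Fin T → ℝ} (h : EffRationalizes U D e)
    {s t : Fin T} (hst : cost (D.price s) (D.bundle t) ≤ e s * D.expenditure s) :
    U (D.bundle t) ≤ U (D.bundle s) := h s _ hst

lemma EffRationalizes.apply_lt (hU : U ∈ wellBehaved L) {D : Dataset L T} {e : Fin T → ℝ}
    (h : EffRationalizes U D e) {s t : Fin T}
    (hst : cost (D.price s) (D.bundle t) < e s * D.expenditure s) :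
    U (D.bundle t) < U (D.bundle s) :=
  have := D.nonempty_goods s
  apply_lt_of_cost_lt hU (fun q hq => h s q hq.le) hst

lemma effRationalizes_zero (hU : U ∈ wellBehaved L) (D : Dataset L T) :
    EffRationalizes U D fun _ => 0 :=
  (effRationalizes_iff hU fun _ => le_rfl).2 fun t q hq => by
    rw [zero_mul] at hq
    exact absurd hq (cost_nonneg _ _).not_gt

lemma Rationalizes.garp (hU : U ∈ wellBehaved L) {D : Dataset L T} (h : Rationalizes U D) :
    GARP D := by
  rw [rationalizes_iff_eff_one] at h
  intro t s hts hst
  have hle : U (D.bundle s) ≤ U (D.bundle t) := by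
    clear hst
    induction hts with
    | refl => exact le_rfl
    | tail _ hbc ih => exact (h.apply_le (by rw [one_mul]; exact hbc)).trans ih
  exact hle.not_gt (h.apply_lt hU (by rw [one_mul]; exact hst))

lemma wellBehaved_inf {V : Utility L} (hU : U ∈ wellBehaved L) (hV : V ∈ wellBehaved L) :
    (fun q => min (U q) (V q)) ∈ wellBehaved L :=
  ⟨hU.1.min hV.1, fun _ _ h => min_lt_min (hU.2 h) (hV.2 h)⟩

lemma wellBehaved_inf' {ι : Type*} {s : Finset ι} (hs : s.Nonempty) {V : ι → Utility L}
    (hV : ∀ i, V i ∈ wellBehaved L) : (fun q => s.inf' hs fun i => V i q) ∈ wellBehaved L := by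
  refine ⟨Continuous.finset_inf'_apply hs fun i _ => (hV i).1, fun q q' h => ?_⟩
  rw [Finset.lt_inf'_iff]
  exact fun i hi => (Finset.inf'_le _ hi).trans_lt ((hV i).2 h)

end WellBehaved

/-! ### Utilities built from rankings -/

/-- A dataset whose revealed preferences at efficiency levels `e` are contained in a strict ranking
of the observations is `e`-rationalized by a piecewise linear utility function. -/
lemma exists_effRationalizes_of_rank {α : Type*} [LinearOrder α] (D : Dataset L T) {e : Fin T → ℝ}
    (he : ∀ t, e t ≤ 1) (r : Fin T → α)
    (hr : ∀ s t, s ≠ t → cost (D.price s) (D.bundle t) ≤ e s * D.expenditure s → r t < r s) :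
    ∃ U ∈ wellBehaved L, EffRationalizes U D e := by
  classical
  rcases isEmpty_or_nonempty (Fin T) with hT | hT
  · refine ⟨fun q => ∑ i, q.1 i, ⟨by fun_prop, fun q q' h => ?_⟩, fun t => hT.elim t⟩
    obtain ⟨hle, i, hi⟩ := Pi.lt_def.1 (show q.1 < q'.1 from h)
    exact Finset.sum_lt_sum (fun j _ => hle j) ⟨i, Finset.mem_univ i, hi⟩
  let ρ : Fin T → ℝ := fun t => (Finset.univ.filter fun s => r s < r t).card
  have hρ : ∀ s t, r t < r s → ρ t + 1 ≤ ρ s := by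
    intro s t h
    have : (Finset.univ.filter fun x => r x < r t).card <
        (Finset.univ.filter fun x => r x < r s).card := by
      refine Finset.card_lt_card (Finset.ssubset_iff_of_subset ?_ |>.2 ⟨t, ?_⟩)
      · exact fun x hx => by simp at hx ⊢; exact hx.trans h
      · simp [h]
    simp only [ρ]
    exact_mod_cast this
  let g : Fin T → Bundle L → ℝ := fun t q => cost (D.price t) q - e t * D.expenditure t
  have hg : ∀ t, Continuous (g t) := fun t => (continuous_cost _).sub continuous_const
  have hgm : ∀ t, StrictMono (g t) := fun t q q' h => sub_lt_sub_right (cost_strictMono _ h) _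
  obtain ⟨δ, hδ, hδg⟩ : ∃ δ > 0, ∀ s t, -1 ≤ δ * g s (D.bundle t) := by
    obtain ⟨M, hM⟩ := (Set.finite_range fun x : Fin T × Fin T => -g x.1 (D.bundle x.2)).bddAbove
    refine ⟨1 / (|M| + 1), by positivity, fun s t => ?_⟩
    have : -g s (D.bundle t) ≤ M := hM ⟨(s, t), rfl⟩
    rw [div_mul_eq_mul_div, one_mul, le_div_iff₀ (by positivity)]
    linarith [le_abs_self M]
  obtain ⟨N, hN, hNg⟩ : ∃ N ≥ 0, ∀ s t, 0 < g s (D.bundle t) → ρ t ≤ N * g s (D.bundle t) := by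
    obtain ⟨N, hN⟩ := (Set.finite_range fun x : Fin T × Fin T =>
      ρ x.2 / g x.1 (D.bundle x.2)).bddAbove
    refine ⟨|N|, abs_nonneg N, fun s t h => ?_⟩
    rw [← div_le_iff₀ h]
    exact (hN ⟨(s, t), rfl⟩).trans (le_abs_self N)
  -- The utility is the minimum of the `V t`. On the budget of `t`, `V t ≤ ρ t`. At the bundle of
  -- `t`, every `V s` is at least `ρ t`: an unaffordable bundle is lifted by `N`, while an
  -- affordable one with `s ≠ t` has `ρ s ≥ ρ t + 1` and loses at most 1 through `δ`.
  let V : Fin T → Utility L := fun t q => ρ t + δ * g t q + N * max (g t q) 0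
  have hV : ∀ t, V t ∈ wellBehaved L := fun t => by
    refine ⟨by dsimp only [V]; have := hg t; fun_prop, fun q q' h => ?_⟩
    have h1 := mul_lt_mul_of_pos_left (hgm t h) hδ
    have h2 := mul_le_mul_of_nonneg_left (max_le_max_right 0 (hgm t h).le) hN
    dsimp only [V]
    linarith
  refine ⟨_, wellBehaved_inf' Finset.univ_nonempty hV, fun t q hq => ?_⟩
  have hgq : g t q ≤ 0 := sub_nonpos.2 hq
  have h1 : V t q ≤ ρ t := by
    dsimp only [V]
    rw [max_eq_right hgq]
    nlinarith
  refine (Finset.inf'_le _ (Finset.mem_univ t)).trans (h1.trans (Finset.le_inf' _ _ fun s _ => ?_))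
  dsimp only [V]
  rcases lt_or_ge 0 (g s (D.bundle t)) with h | h
  · have := hNg s t h
    rw [max_eq_left h.le]
    have : 0 ≤ ρ s := Nat.cast_nonneg _
    nlinarith
  · rw [max_eq_right h]
    by_cases hst : s = t
    · subst hst
      have : 0 ≤ g s (D.bundle s) := by
        have := mul_le_mul_of_nonneg_right (he s) (D.expenditure_pos s).le
        rw [one_mul] at this
        exact sub_nonneg.2 this
      nlinarith
    · have := hρ s t (hr s t hst (sub_nonpos.1 h))
      linarith [hδg s t]

/-- Breaking ties between observations in favour of observation `t`. -/
lemma exists_effRationalizes_of_tie_break {U : Utility L} (hU : U ∈ wellBehaved L)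
    {D : Dataset L T} {e e' : Fin T → ℝ} (h : EffRationalizes U D e) (he' : ∀ t, e' t ≤ 1)
    (t : Fin T) (hee' : ∀ s s', s ≠ s' →
      cost (D.price s) (D.bundle s') ≤ e' s * D.expenditure s →
        cost (D.price s) (D.bundle s') < e s * D.expenditure s ∨
          s = t ∧ cost (D.price s) (D.bundle s') ≤ e s * D.expenditure s) :
    ∃ U' ∈ wellBehaved L, EffRationalizes U' D e' := by
  -- The ranking is lexicographic: utility first, then priority to `t`. Relations strict under `e`
  -- lower the utility; the weak ones start at `t`, which wins ties.
  refine exists_effRationalizes_of_rank D he'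
    (fun s => toLex (U (D.bundle s), if s = t then (1 : ℝ) else 0)) fun s s' hss hc => ?_
  rw [Prod.Lex.toLex_lt_toLex]
  rcases hee' s s' hss hc with h1 | ⟨rfl, h1⟩
  · exact Or.inl (h.apply_lt hU h1)
  · rcases (h.apply_le h1).lt_or_eq with h2 | h2
    · exact Or.inl h2
    · exact Or.inr ⟨h2, by simp [hss.symm]⟩

variable {U : Utility L}

/-! ### The Afriat loss -/

section Afriat

lemma exists_isGreatest_afriat (hU : U ∈ wellBehaved L) (D : Dataset L T) :
    IsGreatest {e : ℝ | e ∈ Set.Icc (0 : ℝ) 1 ∧ EffRationalizes U D fun _ => e}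
      (1 - afriatLoss L T U D) := by
  have hc : IsClosed {e : ℝ | e ∈ Set.Icc (0 : ℝ) 1 ∧ EffRationalizes U D fun _ => e} := by
    have h := isClosed_effRationalizes (X := Set.Icc (0 : ℝ) 1) hU D (e := fun x _ => (x : ℝ))
      (by fun_prop) (fun x _ => x.2.1)
    convert isClosed_Icc.isClosedMap_subtype_val _ h using 1
    ext e
    simp [and_comm]
  have hb : BddAbove {e : ℝ | e ∈ Set.Icc (0 : ℝ) 1 ∧ EffRationalizes U D fun _ => e} :=
    ⟨1, fun e he => he.1.2⟩
  have hne : {e : ℝ | e ∈ Set.Icc (0 : ℝ) 1 ∧ EffRationalizes U D fun _ => e}.Nonempty :=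
    ⟨0, by simp, effRationalizes_zero hU D⟩
  rw [show 1 - afriatLoss L T U D = _ from sub_sub_cancel _ _]
  exact ⟨hc.csSup_mem hne hb, fun e he => le_csSup hb he⟩

theorem accurate_afriatLoss : Accurate (wellBehaved L) (afriatLoss L) := by
  intro U hU T D
  have h := exists_isGreatest_afriat hU D
  rw [rationalizes_iff_eff_one]
  refine ⟨fun h0 => ?_, fun h1 => ?_⟩
  · have := h.1.2
    rwa [h0, sub_zero] at this
  · have h2 := h.2 ⟨by simp, h1⟩
    have h3 := h.1.1.2
    linarith

/-- Normalized costs, at which revealed preferences switch. -/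
noncomputable def costRatio (D : Dataset L T) (s t : Fin T) : ℝ :=
  cost (D.price s) (D.bundle t) / D.expenditure s

lemma costRatio_pos (D : Dataset L T) (s t : Fin T) : 0 < costRatio D s t :=
  div_pos (D.cost_pos s t) (D.expenditure_pos s)

lemma costRatio_le {D : Dataset L T} {s t : Fin T} {e : ℝ} :
    costRatio D s t ≤ e ↔ cost (D.price s) (D.bundle t) ≤ e * D.expenditure s :=
  div_le_iff₀ (D.expenditure_pos s)

lemma costRatio_lt {D : Dataset L T} {s t : Fin T} {e : ℝ} :
    costRatio D s t < e ↔ cost (D.price s) (D.bundle t) < e * D.expenditure s :=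
  div_lt_iff₀ (D.expenditure_pos s)

/-- Off-diagonal normalized costs differ from each other and from the diagonal ones. -/
def Generic (D : Dataset L T) : Prop :=
  ∀ s s' r r', s ≠ s' → (s, s') ≠ (r, r') → costRatio D s s' ≠ costRatio D r r'

/-- At the largest level `e < 1` attained by `U`, genericity leaves at most one observation with an
off-diagonal ratio equal to `e`. Ties are broken in its favour, and the level can rise. -/
lemma argmin_afriatLoss_eq_empty {D : Dataset L T} (hD : ¬ GARP D) (hg : Generic D) :
    argmin (wellBehaved L) (afriatLoss L) D = ∅ := by
  classical
  by_contra hne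
  obtain ⟨U, hU, hmin⟩ := Set.nonempty_iff_ne_empty.2 hne
  obtain ⟨⟨⟨he0, he1⟩, he⟩, -⟩ := exists_isGreatest_afriat hU D
  set e := 1 - afriatLoss L T U D with he_def
  have he1 : e < 1 := by
    refine lt_of_le_of_ne he1 fun h => hD ?_
    rw [h] at he
    exact (rationalizes_iff_eff_one.2 he).garp hU
  obtain ⟨t, ht⟩ : ∃ t : Fin T, ∀ s s', s ≠ s' → costRatio D s s' = e → s = t := by
    by_cases h : ∃ t t', t ≠ t' ∧ costRatio D t t' = e
    · obtain ⟨t, t', htt', hte⟩ := h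
      refine ⟨t, fun s s' hss' hse => ?_⟩
      by_contra hst
      exact hg s s' t t' hss' (fun h => hst (Prod.ext_iff.1 h).1) (hse.trans hte.symm)
    · push Not at h
      have : Nonempty (Fin T) := by
        by_contra hT
        rw [not_nonempty_iff] at hT
        exact hD fun t => hT.elim t
      exact ⟨Classical.arbitrary _, fun s s' hss' hse => absurd hse (h s s' hss')⟩
  -- There are finitely many ratios, so none lies in `(e, e']` for `e'` close to `e`.
  obtain ⟨e', ⟨hee', he'1⟩, he'⟩ : ∃ e', (e < e' ∧ e' ≤ 1) ∧
      ∀ s s', costRatio D s s' ≤ e' → costRatio D s s' ≤ e := by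
    have h1 : ∀ᶠ x in nhdsWithin e (Set.Ioi e), ∀ s s', costRatio D s s' ≤ x →
        costRatio D s s' ≤ e := by
      refine Filter.eventually_all.2 fun s => Filter.eventually_all.2 fun s' => ?_
      by_cases h : costRatio D s s' ≤ e
      · simp [h]
      · filter_upwards [nhdsWithin_le_nhds (Iio_mem_nhds (not_le.1 h))] with x hx hx'
        exact absurd hx hx'.not_gt
    obtain ⟨x, hx', hx⟩ := (h1.and (Ioc_mem_nhdsGT he1)).exists
    exact ⟨x, hx, hx'⟩
  obtain ⟨U', hU', hr⟩ := exists_effRationalizes_of_tie_break hU he (e' := fun _ => e')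
    (fun _ => he'1) t fun s s' hss' hc => by
      rw [← costRatio_le] at hc
      rw [← costRatio_le, ← costRatio_lt]
      rcases (he' s s' hc).lt_or_eq with h | h
      · exact Or.inl h
      · exact Or.inr ⟨ht s s' hss' h, h.le⟩
  have h1 := (exists_isGreatest_afriat hU' D).2 ⟨⟨he0.trans hee'.le, he'1⟩, hr⟩
  have h2 := hmin U' hU'
  linarith

lemma isOpen_generic : IsOpen {D : Dataset L T | Generic D} := by
  have hc : ∀ s t, Continuous fun D : Dataset L T => costRatio D s t := fun s t =>
    (continuous_cost_dataset s t).div (continuous_cost_dataset s s)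
      fun D => (D.expenditure_pos s).ne'
  simp only [Generic, Set.ofPred_forall]
  exact isOpen_iInter_of_finite fun s => isOpen_iInter_of_finite fun s' =>
    isOpen_iInter_of_finite fun r => isOpen_iInter_of_finite fun r' =>
    isOpen_iInter_of_finite fun _ => isOpen_iInter_of_finite fun _ =>
    isOpen_ne_fun (hc s s') (hc r r')

/-- The bundle of observation `s` is multiplied by `exp (ε * g s)`. -/
noncomputable def rescale (g : Fin T → ℝ) (D : Dataset L T) (ε : ℝ) : Dataset L T := fun s =>
  (⟨⟨Real.exp (ε * g s) • (D.bundle s).1, smul_nonneg (Real.exp_pos _).le (D.bundle s).2⟩,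
    smul_ne_zero (Real.exp_pos _).ne' (D.bundle_ne_zero s)⟩, D.price s)

lemma cost_rescale (g : Fin T → ℝ) (D : Dataset L T) (ε : ℝ) (s t : Fin T) :
    cost ((rescale g D ε).price s) ((rescale g D ε).bundle t) =
      Real.exp (ε * g t) * cost (D.price s) (D.bundle t) := by
  simp [cost, rescale, Dataset.price, Dataset.bundle, dotProduct_smul]

lemma costRatio_rescale (g : Fin T → ℝ) (D : Dataset L T) (ε : ℝ) (s t : Fin T) :
    costRatio (rescale g D ε) s t = Real.exp (ε * (g t - g s)) * costRatio D s t := by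
  have h := (D.expenditure_pos s).ne'
  rw [costRatio, Dataset.expenditure, cost_rescale, cost_rescale, costRatio, mul_sub, Real.exp_sub]
  unfold Dataset.expenditure at h ⊢
  field_simp

lemma rescale_zero (g : Fin T → ℝ) (D : Dataset L T) : rescale g D 0 = D := by
  funext s
  refine Prod.ext (Subtype.ext (Subtype.ext ?_)) rfl
  simp [rescale, Dataset.bundle]

lemma continuous_rescale (g : Fin T → ℝ) (D : Dataset L T) : Continuous (rescale g D) := by
  refine continuous_pi fun s => Continuous.prodMk ?_ continuous_const
  refine Continuous.subtype_mk (Continuous.subtype_mk ?_ _) _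
  fun_prop

/-- After rearrangement this is uniqueness of a sum of two powers of two: an exponent strictly above
both exponents on the other side makes its side too large. -/
lemma two_pow_sub_injective {a b c d : ℕ} (hab : a ≠ b)
    (h : (2 : ℝ) ^ a - 2 ^ b = 2 ^ c - 2 ^ d) : a = c ∧ b = d := by
  have h' : 2 ^ a + 2 ^ d = 2 ^ c + 2 ^ b := by
    have : (2 : ℝ) ^ a + 2 ^ d = 2 ^ c + 2 ^ b := by linarith
    exact_mod_cast this
  have key : ∀ a b c d : ℕ, 2 ^ a + 2 ^ d = 2 ^ c + 2 ^ b → c < a → b < a → False := by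
    intro a b c d h hc hb
    have h1 : 2 * 2 ^ c ≤ 2 ^ a := by rw [← pow_succ']; exact Nat.pow_le_pow_right two_pos hc
    have h2 : 2 * 2 ^ b ≤ 2 ^ a := by rw [← pow_succ']; exact Nat.pow_le_pow_right two_pos hb
    have h3 : 0 < 2 ^ d := by positivity
    omega
  have pinj : ∀ {m n : ℕ}, 2 ^ m = 2 ^ n → m = n := fun h => Nat.pow_right_injective le_rfl h
  have hac : a = c := by
    rcases lt_trichotomy a c with h1 | h1 | h1
    · rcases lt_trichotomy d c with h2 | h2 | h2
      · exact (key c d a b (by omega) h1 h2).elim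
      · subst h2
        exact absurd (pinj (by omega)) hab
      · rcases lt_trichotomy d b with h3 | h3 | h3
        · exact (key b a d c (by omega) h3 (by omega)).elim
        · subst h3
          exact pinj (by omega)
        · exact (key d b c a (by omega) h2 h3).elim
    · exact h1
    · rcases lt_trichotomy a b with h2 | h2 | h2
      · rcases lt_trichotomy d b with h3 | h3 | h3
        · exact (key b a d c (by omega) h3 h2).elim
        · subst h3
          exact pinj (by omega)
        · exact (key d b c a (by omega) (by omega) h3).elim
      · exact absurd h2 hab
      · exact (key a b c d h' h1 h2).elim
  subst hac
  exact ⟨rfl, pinj (by omega)⟩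

/-- A chain can be taken without repetitions. A new starting point either already has a ranked chain
to `b`, or lies off the existing one and can be placed above `c` without disturbing it. -/
lemma exists_rank_of_reflTransGen {V : Type*} {r : V → V → Prop} {a b : V}
    (h : Relation.ReflTransGen r a b) :
    ∃ ρ : V → ℕ, Relation.ReflTransGen (fun x y => r x y ∧ ρ y < ρ x) a b := by
  classical
  induction h using Relation.ReflTransGen.head_induction_on with
  | refl => exact ⟨fun _ => 0, .refl⟩
  | @head a c hac hcb ih =>
    obtain ⟨ρ, hρ⟩ := ih
    by_cases ha : Relation.ReflTransGen (fun x y => r x y ∧ ρ y < ρ x) a b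
    · exact ⟨ρ, ha⟩
    have hne : ∀ x, Relation.ReflTransGen (fun x y => r x y ∧ ρ y < ρ x) x b → x ≠ a := by
      rintro x hx rfl
      exact ha hx
    refine ⟨Function.update ρ a (ρ c + 1), .head ⟨hac, ?_⟩ ?_⟩
    · rw [Function.update_self, Function.update_of_ne (hne c hρ)]
      exact Nat.lt_succ_self _
    · clear hac hcb
      generalize ρ c + 1 = k
      induction hρ using Relation.ReflTransGen.head_induction_on with
      | refl => exact .refl
      | @head x y hxy hyb ih' =>
        refine .head ⟨hxy.1, ?_⟩ ih'
        rw [Function.update_of_ne (hne y hyb), Function.update_of_ne (hne x (.head hxy hyb))]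
        exact hxy.2

/-- Bundles are rescaled so that those earlier in a violating chain grow faster: ratios along the
chain do not increase, and the final strict preference survives small changes. -/
lemma exists_tendsto_generic {D : Dataset L T} (hD : ¬ GARP D) :
    ∃ D' : ℝ → Dataset L T, Filter.Tendsto D' (nhdsWithin 0 (Set.Ioi 0)) (nhds D) ∧
      ∀ᶠ ε in nhdsWithin 0 (Set.Ioi 0), ¬ GARP (D' ε) ∧ Generic (D' ε) := by
  unfold GARP at hD
  push Not at hD
  obtain ⟨t, s, hts, hst⟩ := hD
  obtain ⟨ρ, hρ⟩ := exists_rank_of_reflTransGen hts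
  -- An injective refinement of `ρ`, with the index as tie-breaker. Powers of two then give distinct
  -- nonzero pairwise differences.
  let n : Fin T → ℕ := fun x => ρ x * T + x
  have hn : ∀ x y, ρ y < ρ x → n y < n x := by
    intro x y h
    have h1 : (ρ y + 1) * T ≤ ρ x * T := Nat.mul_le_mul_right T h
    have h2 := y.2
    simp only [n]
    nlinarith
  have hninj : Function.Injective n := by
    intro x y h
    rcases lt_trichotomy (ρ x) (ρ y) with h1 | h1 | h1
    · exact absurd h (hn _ _ h1).ne
    · simp only [n, h1] at h
      exact Fin.ext (by omega)
    · exact absurd h (hn _ _ h1).ne'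
  let g : Fin T → ℝ := fun x => 2 ^ n x
  have hlim : Filter.Tendsto (rescale g D) (nhdsWithin 0 (Set.Ioi 0)) (nhds D) := by
    have := (continuous_rescale g D).tendsto 0
    rw [rescale_zero] at this
    exact this.mono_left nhdsWithin_le_nhds
  refine ⟨rescale g D, hlim, ?_⟩
  have h1 : ∀ᶠ ε in nhdsWithin 0 (Set.Ioi 0), StrictRP (rescale g D ε) s t :=
    hlim.eventually ((isOpen_lt (continuous_cost_dataset s t)
      (continuous_cost_dataset s s)).mem_nhds hst)
  have h2 : ∀ᶠ ε in nhdsWithin 0 (Set.Ioi 0), Generic (rescale g D ε) := by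
    refine Filter.eventually_all.2 fun x => Filter.eventually_all.2 fun x' =>
      Filter.eventually_all.2 fun y => Filter.eventually_all.2 fun y' =>
      Filter.eventually_all.2 fun hx => Filter.eventually_all.2 fun hxy => ?_
    -- In logarithms, equality of two ratios is a linear equation in `ε` with nonzero slope, so it
    -- has at most one solution.
    have hs : {ε | costRatio (rescale g D ε) x x' = costRatio (rescale g D ε) y y'}.Subsingleton := by
      intro ε hε η hη
      have hk : (g x' - g x) - (g y' - g y) ≠ 0 := by
        intro h0
        obtain ⟨h3, h4⟩ := two_pow_sub_injective (hninj.ne hx.symm) (sub_eq_zero.1 h0)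
        exact hxy (Prod.ext (hninj h4) (hninj h3))
      have hlog : ∀ z, costRatio (rescale g D z) x x' = costRatio (rescale g D z) y y' →
          z * ((g x' - g x) - (g y' - g y)) =
            Real.log (costRatio D y y') - Real.log (costRatio D x x') := by
        intro z hz
        rw [costRatio_rescale, costRatio_rescale] at hz
        have := congrArg Real.log hz
        rw [Real.log_mul (Real.exp_pos _).ne' (costRatio_pos D _ _).ne',
          Real.log_mul (Real.exp_pos _).ne' (costRatio_pos D _ _).ne', Real.log_exp,
          Real.log_exp] at this
        linarith
      exact mul_right_cancel₀ hk ((hlog ε hε).trans (hlog η hη).symm)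
    have h3 := (hs.finite.subset (Set.sdiff_subset (t := {0}))).isClosed.isOpen_compl.mem_nhds
      (show (0 : ℝ) ∈ _ by simp)
    filter_upwards [nhdsWithin_le_nhds h3, self_mem_nhdsWithin] with ε h4 h5 h6
    exact h4 ⟨h6, (Set.mem_Ioi.1 h5).ne'⟩
  filter_upwards [h1, h2, self_mem_nhdsWithin] with ε h3 h4 h5
  refine ⟨fun hG => hG t s (Relation.ReflTransGen.mono (fun x y hxy => ?_) _ _ hρ) h3, h4⟩
  rw [DirectRP, Dataset.expenditure, cost_rescale, cost_rescale]
  have h6 : g y ≤ g x := pow_le_pow_right₀ one_le_two (hn x y hxy.2).le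
  exact mul_le_mul (Real.exp_le_exp.2 (mul_le_mul_of_nonneg_left h6 (le_of_lt h5))) hxy.1
    (D.cost_pos _ _).le (Real.exp_pos _).le

theorem isNowhereDense_argmin_afriatLoss :
    IsNowhereDense {D : {D : Dataset L T // ¬ GARP D} |
      (argmin (wellBehaved L) (afriatLoss L) D.1).Nonempty} := by
  have hO : IsOpen {D : {D : Dataset L T // ¬ GARP D} | Generic D.1} :=
    isOpen_generic.preimage continuous_subtype_val
  have hd : Dense {D : {D : Dataset L T // ¬ GARP D} | Generic D.1} := by
    rintro ⟨D, hD⟩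
    obtain ⟨D', hlim, hev⟩ := exists_tendsto_generic hD
    rw [closure_subtype]
    refine mem_closure_of_tendsto hlim (hev.mono fun ε h => ⟨⟨_, h.1⟩, h.2, rfl⟩)
  refine IsNowhereDense.mono (s := {D : {D : Dataset L T // ¬ GARP D} | Generic D.1}ᶜ) ?_ ?_
  · intro D hD hg
    exact hD.ne_empty (argmin_afriatLoss_eq_empty D.2 hg)
  · rw [hO.isClosed_compl.isNowhereDense_iff]
    exact interior_eq_empty_iff_dense_compl.2 (by rwa [compl_compl])

end Afriat

/-! ### The Varian loss -/

section Varian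

variable {f : ∀ T : ℕ, (Fin T → unitInterval) → ℝ}

lemma exists_varianLoss_eq (hf : ∀ T, IsVarianAggregator (f T)) (hU : U ∈ wellBehaved L)
    (D : Dataset L T) : ∃ e : Fin T → unitInterval,
      EffRationalizes U D (fun t => (e t : ℝ)) ∧ varianLoss f T U D = f T e := by
  have hc : IsClosed {e : Fin T → unitInterval | EffRationalizes U D fun t => (e t : ℝ)} :=
    isClosed_effRationalizes hU D (by fun_prop) fun e t => (e t).2.1
  obtain ⟨e, he, hmin⟩ := hc.isCompact.exists_isMinOn
    ⟨fun _ => 0, effRationalizes_zero hU D⟩ (hf T).continuous.continuousOn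
  refine ⟨e, he, (IsLeast.csInf_eq ⟨⟨e, he, rfl⟩, ?_⟩)⟩
  rintro _ ⟨e', he', rfl⟩
  exact hmin he'

lemma varianLoss_le (hf : ∀ T, IsVarianAggregator (f T)) {D : Dataset L T}
    {e : Fin T → unitInterval} (he : EffRationalizes U D fun t => (e t : ℝ)) :
    varianLoss f T U D ≤ f T e :=
  csInf_le ⟨0, by rintro _ ⟨e, -, rfl⟩; exact (hf T).nonneg e⟩ ⟨e, he, rfl⟩

theorem accurate_varianLoss (hf : ∀ T, IsVarianAggregator (f T)) :
    Accurate (wellBehaved L) (varianLoss f) := by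
  intro U hU T D
  obtain ⟨e, he, hVe⟩ := exists_varianLoss_eq hf hU D
  rw [rationalizes_iff_eff_one, hVe]
  refine ⟨fun h0 => ?_, fun h1 => le_antisymm ?_ ((hf T).nonneg e)⟩
  · simpa [((hf T).eq_zero_iff e).1 h0] using he
  · rw [← hVe, ← ((hf T).eq_zero_iff fun _ => 1).2 fun _ => rfl]
    exact varianLoss_le hf (by simpa using h1)

theorem exists_varianLoss_lt (hf : ∀ T, IsVarianAggregator (f T)) (hU : U ∈ wellBehaved L)
    {D : Dataset L T} (hD : ¬ Rationalizes U D) :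
    ∃ U' ∈ wellBehaved L, varianLoss f T U' D < varianLoss f T U D := by
  classical
  obtain ⟨e, he, hVe⟩ := exists_varianLoss_eq hf hU D
  obtain ⟨t, ht⟩ : ∃ t, e t ≠ 1 := by
    by_contra! h
    exact hD (rationalizes_iff_eff_one.2 (by simpa [h] using he))
  have ht1 : (e t : ℝ) < 1 := lt_of_le_of_ne (e t).2.2 fun h => ht (Subtype.ext h)
  -- Raising `e t` to `η` creates no new relation from `t`.
  obtain ⟨η, ⟨hη, hη1⟩, hηc⟩ : ∃ η, ((e t : ℝ) < η ∧ η ≤ 1) ∧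
      ∀ s, costRatio D t s ≤ η → costRatio D t s ≤ e t := by
    have h1 : ∀ᶠ x in nhdsWithin (e t : ℝ) (Set.Ioi (e t : ℝ)), ∀ s, costRatio D t s ≤ x →
        costRatio D t s ≤ e t := by
      refine Filter.eventually_all.2 fun s' => ?_
      by_cases h : costRatio D t s' ≤ e t
      · simp [h]
      · filter_upwards [nhdsWithin_le_nhds (Iio_mem_nhds (not_le.1 h))] with x hx hx'
        exact absurd hx hx'.not_gt
    obtain ⟨x, hx', hx⟩ := (h1.and (Ioc_mem_nhdsGT ht1)).exists
    exact ⟨x, hx, hx'⟩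
  let b : unitInterval := ⟨η, (e t).2.1.trans hη.le, hη1⟩
  -- At `c = 1` only coordinate `t` changes, and the loss drops strictly; by continuity it still
  -- drops for some `c < 1`. The factor `c` turns the remaining relations from the other
  -- observations into strict ones under `e`.
  let e' : unitInterval → Fin T → unitInterval := fun c => Function.update (fun s => c * e s) t b
  have hcont : Continuous e' :=
    (continuous_pi fun s => by fun_prop : Continuous fun (c : unitInterval) (s : Fin T) => c * e s).update
      t continuous_const
  have he'1 : f T (e' 1) < f T e := by
    refine (hf T).strictAnti (Pi.lt_def.2 ⟨fun s => ?_, t, ?_⟩)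
    · by_cases hs : s = t
      · subst hs
        simpa [e', b] using Subtype.coe_le_coe.1 hη.le
      · simp [e', hs]
    · simpa [e', b] using Subtype.coe_lt_coe.1 hη
  have hev : ∀ᶠ c in nhdsWithin (1 : unitInterval) (Set.Iio 1), f T (e' c) < f T e :=
    (((hf T).continuous.comp hcont).tendsto 1).eventually_lt_const he'1 |>.filter_mono
      nhdsWithin_le_nhds
  have : (nhdsWithin (1 : unitInterval) (Set.Iio 1)).NeBot := nhdsLT_neBot_of_exists_lt ⟨0, by simp⟩
  obtain ⟨c, hc, hc1⟩ := (hev.and self_mem_nhdsWithin).exists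
  obtain ⟨U', hU', hr⟩ := exists_effRationalizes_of_tie_break hU he
    (e' := fun s => (e' c s : ℝ)) (fun s => (e' c s).2.2) t fun s s' hss' hle => by
      by_cases hs : s = t
      · subst hs
        refine Or.inr ⟨rfl, ?_⟩
        rw [← costRatio_le] at hle ⊢
        refine hηc s' ?_
        simpa [e', b] using hle
      · left
        rw [← costRatio_le] at hle
        rw [← costRatio_lt]
        simp only [e', Function.update_of_ne hs, Set.Icc.coe_mul] at hle
        have h0 := costRatio_pos D s s'
        have hc1 : (c : ℝ) < 1 := hc1
        have : 0 < (e s : ℝ) := lt_of_le_of_ne (e s).2.1 fun h => by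
          rw [← h] at hle
          linarith
        nlinarith
  exact ⟨U', hU', (varianLoss_le hf hr).trans_lt (hc.trans_eq hVe.symm)⟩

end Varian

/-! ### The Swaps loss -/

lemma exists_of_not_rationalizes (hU : U ∈ wellBehaved L) {D : Dataset L T}
    (h : ¬ Rationalizes U D) :
    ∃ t q, cost (D.price t) q < D.expenditure t ∧ U (D.bundle t) < U q := by
  rw [rationalizes_iff_eff_one, effRationalizes_iff hU fun _ => zero_le_one] at h
  push Not at h
  simpa only [one_mul] using h

/-- A well-behaved utility function can be lowered at one bundle without being raised anywhere or
changed on a finite set of other bundles. -/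
lemma exists_lowering (hU : U ∈ wellBehaved L) {F : Set (Bundle L)} (hF : F.Finite) {y : Bundle L}
    (hy : y ∉ F) :
    ∃ U' ∈ wellBehaved L, (∀ q, U' q ≤ U q) ∧ (∀ q ∈ F, U' q = U q) ∧ U' y < U y := by
  obtain ⟨ε, hεF, hε⟩ : ∃ ε : ℝ, (∀ q ∈ F, q ≤ y → U q ≤ U y - 2 * ε) ∧ 0 < ε := by
    have h : ∀ᶠ ε : ℝ in nhdsWithin 0 (Set.Ioi 0), ∀ q ∈ F, q ≤ y → U q ≤ U y - 2 * ε := by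
      refine (Filter.eventually_all_finite hF).2 fun q hq => Filter.eventually_all.2 fun hqy => ?_
      have hlt : U q < U y := hU.2 (lt_of_le_of_ne hqy fun h => hy (h ▸ hq))
      filter_upwards [nhdsWithin_le_nhds (Iio_mem_nhds (show 0 < (U y - U q) / 2 by linarith))]
        with ε hε
      linarith [Set.mem_Iio.1 hε]
    exact (h.and self_mem_nhdsWithin).exists
  let σ : Bundle L → ℝ := fun z => ∑ i, z.1 i
  let n : Bundle L → ℝ := fun z => ∑ i, max (z.1 i - y.1 i) 0
  have hσ : StrictMono σ := fun q q' h => by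
    obtain ⟨hle, i, hi⟩ := Pi.lt_def.1 (show q.1 < q'.1 from h)
    exact Finset.sum_lt_sum (fun j _ => hle j) ⟨i, Finset.mem_univ i, hi⟩
  have hσ0 : ∀ z, 0 ≤ σ z := fun z => Finset.sum_nonneg fun i _ => z.2 i
  have hn0 : ∀ z, 0 ≤ n z := fun z => Finset.sum_nonneg fun i _ => le_max_right _ _
  have hnm : Monotone n := fun q q' h =>
    Finset.sum_le_sum fun i _ => max_le_max_right 0 (sub_le_sub_right (h i) _)
  have hny : n y = 0 := by simp [n]
  have hnpos : ∀ q, ¬ q ≤ y → 0 < n q := fun q hq => by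
    obtain ⟨i, hi⟩ := not_forall.1 (show ¬ ∀ i, q.1 i ≤ y.1 i from hq)
    exact Finset.sum_pos' (fun i _ => le_max_right _ _)
      ⟨i, Finset.mem_univ i, lt_max_of_lt_left (sub_pos.2 (not_le.1 hi))⟩
  obtain ⟨N, hNF, hN⟩ : ∃ N : ℝ, (∀ q ∈ F, ¬ q ≤ y → U q - U y + 2 * ε ≤ N * n q) ∧ 0 ≤ N := by
    have h : ∀ᶠ N : ℝ in Filter.atTop, ∀ q ∈ F, ¬ q ≤ y → U q - U y + 2 * ε ≤ N * n q :=
      (Filter.eventually_all_finite hF).2 fun q hq => Filter.eventually_all.2 fun hqy =>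
        (Filter.tendsto_id.atTop_mul_const (hnpos q hqy)).eventually_ge_atTop _
    exact (h.and (Filter.eventually_ge_atTop 0)).exists
  obtain ⟨δ, hδ, hδε⟩ : ∃ δ > 0, δ * σ y ≤ ε := by
    refine ⟨ε / (σ y + 1), div_pos hε (by linarith [hσ0 y]), ?_⟩
    rw [div_mul_eq_mul_div, div_le_iff₀ (by linarith [hσ0 y])]
    nlinarith
  -- The new utility is `min U V`, with `V y = U y - ε`. Since `δ * σ y ≤ ε`, `V` is at least `U y -
  -- 2 * ε` everywhere, which dominates `U` on points of `F` below `y`; at the other points of `F`,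
  -- `n` is positive and the term `N * n` suffices.
  let V : Utility L := fun z => U y - ε + δ * (σ z - σ y) + N * n z
  have hV : V ∈ wellBehaved L := by
    refine ⟨?_, fun q q' h => ?_⟩
    · have hc : ∀ i, Continuous fun q : Bundle L => q.1 i := fun i =>
        (continuous_apply i).comp continuous_subtype_val
      have hσc : Continuous σ := continuous_finsetSum _ fun i _ => hc i
      have hnc : Continuous n :=
        continuous_finsetSum _ fun i _ => ((hc i).sub continuous_const).max continuous_const
      dsimp only [V]
      fun_prop
    · have h1 := mul_lt_mul_of_pos_left (hσ h) hδ
      have h2 := mul_le_mul_of_nonneg_left (hnm h.le) hN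
      dsimp only [V]
      linarith
  refine ⟨_, wellBehaved_inf hU hV, fun q => min_le_left _ _, fun q hq => min_eq_left ?_,
    min_lt_of_right_lt ?_⟩
  · have h1 := mul_nonneg hδ.le (hσ0 q)
    by_cases hqy : q ≤ y
    · have h2 := hεF q hq hqy
      have h3 := mul_nonneg hN (hn0 q)
      dsimp only [V]
      linarith
    · have h2 := hNF q hq hqy
      dsimp only [V]
      linarith
  · simp [V, hny, hε]

/-- With at least two goods, an indifference curve that cuts through a budget set has a point in the
interior of the budget set which avoids any given finite set. -/
lemma exists_indifferent_notMem (hL : 2 ≤ L) (hU : U ∈ wellBehaved L) {F : Set (Bundle L)}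
    (hF : F.Finite) {p : Price L} {m : ℝ} {b q : Bundle L} (hb : b.1 ≠ 0) (hq : cost p q < m)
    (hbq : U b < U q) : ∃ y, y ∉ F ∧ U y = U b ∧ cost p y < m := by
  have hO : IsOpen {z | cost p z < m ∧ U b < U z} :=
    (isOpen_lt (continuous_cost p) continuous_const).inter (isOpen_lt continuous_const hU.1)
  obtain ⟨c, hc, hx⟩ := exists_translate_mem hO (show q ∈ _ from ⟨hq, hbq⟩)
  set x := translate c q
  have hxpos : ∀ i, 0 < x.1 i := fun i => by
    have := q.2 i
    have := abs_pos_of_pos hc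
    simp only [x, translate]
    exact add_pos_of_nonneg_of_pos ‹_› ‹_›
  let i : Fin L := ⟨0, by omega⟩
  let j : Fin L := ⟨1, by omega⟩
  have hij : j ≠ i := by simp [i, j, Fin.ext_iff]
  -- The rays through the `γ s` have different ratios of goods `i` and `j`, and each meets the
  -- indifference set of `b` before `γ s`. Infinitely many distinct points result, too many for `F`.
  let γ : ℝ → Bundle L := fun s => ⟨fun k => x.1 k + |s| * (Pi.single i (1 : ℝ) : Fin L → ℝ) k,
    fun k => add_nonneg (x.2 k) (mul_nonneg (abs_nonneg s)
      ((Pi.single_nonneg.2 zero_le_one : (0 : Fin L → ℝ) ≤ Pi.single i 1) k))⟩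
  have hγ : Continuous γ := by
    dsimp only [γ]
    fun_prop
  have hγ0 : γ 0 = x := Subtype.ext (by simp [γ])
  have hev : ∀ᶠ s in nhdsWithin 0 (Set.Ioi 0), γ s ∈ {z | cost p z < m ∧ U b < U z} :=
    nhdsWithin_le_nhds (hγ.continuousAt.eventually_mem (by rw [hγ0]; exact hO.mem_nhds hx))
  obtain ⟨η, hη, hsub⟩ := mem_nhdsGT_iff_exists_Ioo_subset.1 hev
  by_contra! hcon
  refine (Set.Ioo_infinite (show (0 : ℝ) < η from hη)) (Set.Finite.subset
    ((hF.image fun z => z.1 i / z.1 j).preimage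
      (f := fun s => (x.1 i + s) / x.1 j) fun s _ s' _ h => ?_) fun s hs => ?_)
  · have := (div_left_inj' (hxpos j).ne').1 h
    linarith
  · obtain ⟨hsm, hsb⟩ := hsub hs
    have hcont : Continuous fun c => U (dilate c (γ s)) := hU.1.comp (continuous_dilate _)
    have h0 : U (dilate 0 (γ s)) < U b := by
      rw [dilate_zero]
      exact hU.2 (zero_lt_bundle hb)
    have h1 : U b < U (dilate 1 (γ s)) := by rwa [dilate_one]
    obtain ⟨c, ⟨hc0, hc1⟩, hcU⟩ := intermediate_value_Icc zero_le_one hcont.continuousOn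
      ⟨h0.le, h1.le⟩
    have hcpos : 0 < c := lt_of_le_of_ne hc0 fun h => by
      subst h
      exact h0.ne hcU
    refine ⟨dilate c (γ s), ?_, ?_⟩
    · by_contra hmem
      refine (hcon _ hmem hcU).not_gt ?_
      rw [cost_dilate, abs_of_pos hcpos]
      nlinarith [cost_nonneg p (γ s)]
    · have hs0 : 0 < s := hs.1
      simp [dilate, γ, abs_of_pos hs0, hij, mul_div_mul_left _ _ (abs_pos.2 hcpos.ne').ne']

/-- A relatively open set may touch the boundary of the orthant; a small translation finds a point
of it in the interior. -/
lemma volume_image_pos {O : Set (Bundle L)} (hO : IsOpen O) (hne : O.Nonempty) :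
    0 < MeasureTheory.volume ((fun q : Bundle L => (q.1 : Fin L → ℝ)) '' O) := by
  obtain ⟨q, hq⟩ := hne
  obtain ⟨c, hc, hx⟩ := exists_translate_mem hO hq
  obtain ⟨V, hV, rfl⟩ := isOpen_induced_iff.1 hO
  have hopen : IsOpen (V ∩ {z : Fin L → ℝ | ∀ i, 0 < z i}) := by
    refine hV.inter ?_
    simp only [Set.ofPred_forall]
    exact isOpen_iInter_of_finite fun i => isOpen_lt continuous_const (continuous_apply i)
  refine (hopen.measure_pos MeasureTheory.volume ⟨(translate c q).1, hx, fun i => ?_⟩).trans_le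
    (MeasureTheory.measure_mono ?_)
  · exact add_pos_of_nonneg_of_pos (q.2 i) (abs_pos_of_pos hc)
  · exact fun z hz => ⟨⟨z, fun i => (hz.2 i).le⟩, hz.1, rfl⟩

lemma volume_image_lt_top {S : Set (Bundle L)} {p : Price L} {m : ℝ} (hS : S ⊆ budget p m) :
    MeasureTheory.volume ((fun q : Bundle L => (q.1 : Fin L → ℝ)) '' S) < ⊤ :=
  (MeasureTheory.measure_mono (Set.image_mono hS)).trans_lt
    ((isCompact_budget p m).image continuous_subtype_val).measure_lt_top

theorem accurate_swapsLoss : Accurate (wellBehaved L) (swapsLoss L) := by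
  intro U hU T D
  refine ⟨fun h0 => ?_, fun h => Finset.sum_eq_zero fun t _ => ?_⟩
  · by_contra hD
    obtain ⟨t, q, hq, hqU⟩ := exists_of_not_rationalizes hU hD
    have h1 := (Finset.sum_eq_zero_iff_of_nonneg fun t _ => ENNReal.toReal_nonneg).1 h0 t
      (Finset.mem_univ t)
    refine (ENNReal.toReal_pos ?_ (volume_image_lt_top fun q hq => hq.1).ne).ne' h1
    refine ((volume_image_pos ((isOpen_lt (continuous_cost (D.price t)) continuous_const).inter
      (isOpen_lt continuous_const hU.1)) ⟨q, hq, hqU⟩).trans_le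
      (MeasureTheory.measure_mono (Set.image_mono ?_))).ne'
    exact fun z hz => ⟨(show cost _ z < _ from hz.1).le, hz.2⟩
  · have : {q | q ∈ budget (D.price t) (D.expenditure t) ∧ U (D.bundle t) < U q} = ∅ :=
      Set.eq_empty_of_forall_notMem fun q hq => (h t q hq.1).not_gt hq.2
    simp [this]

/-- Lowering `U` at an unobserved `y` indifferent to the bundle of `t` enlarges no swap set, as
observed utilities are unchanged. Bundles slightly above `y` leave the swap set of `t`, and they
fill an open set. -/
theorem exists_swapsLoss_lt (hL : 2 ≤ L) (hU : U ∈ wellBehaved L) {D : Dataset L T}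
    (hD : ¬ Rationalizes U D) :
    ∃ U' ∈ wellBehaved L, swapsLoss L T U' D < swapsLoss L T U D := by
  obtain ⟨t, q, hq, hqU⟩ := exists_of_not_rationalizes hU hD
  obtain ⟨y, hyF, hyU, hyc⟩ := exists_indifferent_notMem hL hU (Set.finite_range D.bundle)
    (D.bundle_ne_zero t) hq hqU
  obtain ⟨U', hU', hle, heq, hlt⟩ := exists_lowering hU (Set.finite_range D.bundle) hyF
  have heq : ∀ s, U' (D.bundle s) = U (D.bundle s) := fun s => heq _ ⟨s, rfl⟩
  have hsub : ∀ s, {q | q ∈ budget (D.price s) (D.expenditure s) ∧ U' (D.bundle s) < U' q} ⊆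
      {q | q ∈ budget (D.price s) (D.expenditure s) ∧ U (D.bundle s) < U q} :=
    fun s z hz => ⟨hz.1, by rw [← heq]; exact hz.2.trans_le (hle z)⟩
  refine ⟨U', hU', Finset.sum_lt_sum (fun s _ => ENNReal.toReal_mono
    (volume_image_lt_top fun q hq => hq.1).ne
    (MeasureTheory.measure_mono (Set.image_mono (hsub s)))) ⟨t, Finset.mem_univ t, ?_⟩⟩
  let O : Set (Bundle L) := {z | (cost (D.price t) z < D.expenditure t ∧ U' z < U (D.bundle t)) ∧
    U (D.bundle t) < U z}
  have hO' : IsOpen {z | cost (D.price t) z < D.expenditure t ∧ U' z < U (D.bundle t)} :=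
    (isOpen_lt (continuous_cost _) continuous_const).inter (isOpen_lt hU'.1 continuous_const)
  have hO : IsOpen O := hO'.inter (isOpen_lt continuous_const hU.1)
  have hOne : O.Nonempty := by
    have := D.nonempty_goods t
    obtain ⟨c, hc, hx⟩ := exists_translate_mem hO' (show y ∈ _ from ⟨hyc, hyU ▸ hlt⟩)
    exact ⟨_, hx, hyU ▸ hU.2 (lt_translate hc y)⟩
  refine ENNReal.toReal_strict_mono (volume_image_lt_top fun q hq => hq.1).ne ?_
  have hval : MeasurableEmbedding (fun q : Bundle L => (q.1 : Fin L → ℝ)) :=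
    MeasurableEmbedding.subtype_coe measurableSet_Ici
  refine lt_of_lt_of_le ?_ (MeasureTheory.measure_mono (Set.image_mono
    (Set.union_subset (hsub t) (t := O) fun z hz => ⟨hz.1.1.le, hz.2⟩)))
  rw [Set.image_union, MeasureTheory.measure_union _ (hval.measurableSet_image.2 hO.measurableSet)]
  · exact ENNReal.lt_add_right (volume_image_lt_top fun q hq => hq.1).ne
      (volume_image_pos hO hOne).ne'
  · refine (Set.disjoint_image_iff Subtype.val_injective).2 (Set.disjoint_left.2 fun z hz hz' => ?_)
    exact (hz.2.trans hz'.1.2).ne (heq t)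

/-! ### The least squares loss -/

/-- The weighted sum of squared distances between two tuples of bundles. -/
def squaredLoss (M : Fin T → Matrix (Fin L) (Fin L) ℝ) (b x : Fin T → Fin L → ℝ) : ℝ :=
  ∑ t, (b t - x t) ⬝ᵥ (M t *ᵥ (b t - x t))

lemma continuous_squaredLoss (M : Fin T → Matrix (Fin L) (Fin L) ℝ) (b : Fin T → Fin L → ℝ) :
    Continuous (squaredLoss M b) := by
  unfold squaredLoss
  fun_prop

lemma dotProduct_mulVec_nonneg {M : Matrix (Fin L) (Fin L) ℝ} (hM : M.PosDef) (v : Fin L → ℝ) :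
    0 ≤ v ⬝ᵥ (M *ᵥ v) := by
  simpa using hM.posSemidef.dotProduct_mulVec_nonneg v

lemma dotProduct_mulVec_pos {M : Matrix (Fin L) (Fin L) ℝ} (hM : M.PosDef) {v : Fin L → ℝ}
    (hv : v ≠ 0) : 0 < v ⬝ᵥ (M *ᵥ v) := by
  simpa using hM.dotProduct_mulVec_pos hv

lemma squaredLoss_nonneg {M : Fin T → Matrix (Fin L) (Fin L) ℝ} (hM : ∀ t, (M t).PosDef)
    (b x : Fin T → Fin L → ℝ) : 0 ≤ squaredLoss M b x :=
  Finset.sum_nonneg fun t _ => dotProduct_mulVec_nonneg (hM t) _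

lemma eq_of_squaredLoss_nonpos {M : Fin T → Matrix (Fin L) (Fin L) ℝ} (hM : ∀ t, (M t).PosDef)
    {b x : Fin T → Fin L → ℝ} (h : squaredLoss M b x ≤ 0) : b = x := by
  funext t
  by_contra hne
  have h1 := (Finset.sum_eq_zero_iff_of_nonneg
    fun t _ => dotProduct_mulVec_nonneg (hM t) (b t - x t)).1
      (h.antisymm (squaredLoss_nonneg hM b x)) t (Finset.mem_univ t)
  exact (dotProduct_mulVec_pos (hM t) (sub_ne_zero.2 hne)).ne' h1

/-- Tuples of affordable, possibly zero, bundles that are optimal for `U` at the expenditure they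
require. -/
def optimalTuples (U : Utility L) (D : Dataset L T) : Set (Fin T → Bundle L) :=
  {x | ∀ t, x t ∈ budget (D.price t) (D.expenditure t) ∧
    ∀ q, cost (D.price t) q < cost (D.price t) (x t) → U q ≤ U (x t)}

lemma isCompact_optimalTuples (hU : Continuous U) (D : Dataset L T) :
    IsCompact (optimalTuples U D) := by
  refine (isCompact_univ_pi fun t => isCompact_budget (D.price t) (D.expenditure t)).of_isClosed_subset
    ?_ fun x hx t _ => (hx t).1
  simp only [optimalTuples, Set.ofPred_forall, Set.ofPred_and]
  refine isClosed_iInter fun t => IsClosed.inter ?_ (isClosed_iInter fun q => ?_)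
  · exact isClosed_le ((continuous_cost _).comp (continuous_apply t)) continuous_const
  · simp only [imp_iff_not_or, Set.ofPred_or, not_lt]
    exact (isClosed_le ((continuous_cost _).comp (continuous_apply t)) continuous_const).union
      (isClosed_le continuous_const (hU.comp (continuous_apply t)))

lemma rationalizes_of_mem_optimalTuples (hU : U ∈ wellBehaved L) {D : Dataset L T}
    {x : Fin T → Bundle L} (hx : x ∈ optimalTuples U D) (h : ∀ t, (D.bundle t).1 = (x t).1) :
    Rationalizes U D := by
  rw [rationalizes_iff_eff_one, effRationalizes_iff hU fun _ => zero_le_one]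
  intro t q hq
  rw [one_mul, Dataset.expenditure, show D.bundle t = x t from Subtype.ext (h t)] at hq
  rw [show D.bundle t = x t from Subtype.ext (h t)]
  exact (hx t).2 q hq

lemma Dataset.bundle_mem_budget (D : Dataset L T) (t : Fin T) :
    D.bundle t ∈ budget (D.price t) (D.expenditure t) :=
  le_refl (D.expenditure t)

section LeastSquares

variable {W : ∀ T : ℕ, Dataset L T → Fin T → Matrix (Fin L) (Fin L) ℝ}

lemma lsLoss_le (hW : ∀ T, IsLSWeight (W T)) {D D' : Dataset L T}
    (hp : ∀ t, D'.price t = D.price t) (hr : Rationalizes U D')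
    (hb : ∀ t, D'.bundle t ∈ budget (D.price t) (D.expenditure t)) :
    lsLoss W T U D ≤
      squaredLoss (W T D) (fun t => (D.bundle t).1) (fun t => (D'.bundle t).1) := by
  refine csInf_le ⟨0, ?_⟩ ⟨D', hp, hr, hb, rfl⟩
  rintro _ ⟨D'', -, -, -, rfl⟩
  exact squaredLoss_nonneg ((hW T).posDef D) _ _

/-- Only an inequality is available: zero bundles are allowed in `optimalTuples` for compactness, so
a minimizer need not be a dataset. -/
lemma exists_squaredLoss_le_lsLoss (hU : U ∈ wellBehaved L) (D : Dataset L T) :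
    ∃ x ∈ optimalTuples U D,
      squaredLoss (W T D) (fun t => (D.bundle t).1) (fun t => (x t).1) ≤ lsLoss W T U D := by
  have hmax : ∀ t, ∃ b ∈ budget (D.price t) (D.expenditure t),
      ∀ q ∈ budget (D.price t) (D.expenditure t), U q ≤ U b := fun t =>
    (isCompact_budget _ _).exists_isMaxOn ⟨D.bundle t, D.bundle_mem_budget t⟩ hU.1.continuousOn
  choose b hb hbmax using hmax
  have hb0 : ∀ t, (b t).1 ≠ 0 := fun t h => by
    have h1 := hbmax t _ (D.bundle_mem_budget t)
    rw [show b t = ⟨0, le_rfl⟩ from Subtype.ext h] at h1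
    exact h1.not_gt (hU.2 (zero_lt_bundle (D.bundle_ne_zero t)))
  obtain ⟨x, hx, hmin⟩ := (isCompact_optimalTuples hU.1 D).exists_isMinOn
    ⟨b, fun t => ⟨hb t, fun q hq => hbmax t q (hq.le.trans (hb t))⟩⟩
    (f := fun x => squaredLoss (W T D) (fun t => (D.bundle t).1) (fun t => (x t).1))
    ((continuous_squaredLoss _ _).comp (by fun_prop)).continuousOn
  refine ⟨x, hx, le_csInf ?_ ?_⟩
  · exact ⟨_, fun t => (⟨b t, hb0 t⟩, D.price t), fun _ => rfl,
      fun t q hq => hbmax t q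
        ((show cost (D.price t) q ≤ cost (D.price t) (b t) from hq).trans (hb t)), hb, rfl⟩
  · rintro _ ⟨D', hp, hr, hb', rfl⟩
    refine hmin (fun t => ⟨hb' t, fun q hq => hr t q ?_⟩)
    rw [← hp] at hq
    exact hq.le

theorem accurate_lsLoss (hW : ∀ T, IsLSWeight (W T)) : Accurate (wellBehaved L) (lsLoss W) := by
  intro U hU T D
  obtain ⟨x, hx, hle⟩ := exists_squaredLoss_le_lsLoss (W := W) hU D
  refine ⟨fun h0 => ?_, fun h => le_antisymm ?_
    ((squaredLoss_nonneg ((hW T).posDef D) _ _).trans hle)⟩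
  · have hxD := eq_of_squaredLoss_nonpos ((hW T).posDef D) (hle.trans h0.le)
    exact rationalizes_of_mem_optimalTuples hU hx (congrFun hxD)
  · refine (lsLoss_le hW (fun _ => rfl) h D.bundle_mem_budget).trans_eq ?_
    simp [squaredLoss]

/-- The sign alternative is what later permits tie-breaking. If `x` exhausts the budget of `q`, then
`q - x` has cost zero. Otherwise some single coordinate of `q - x` is already a descent direction,
and there is slack to follow it. -/
lemma exists_descent_direction {M : Matrix (Fin L) (Fin L) ℝ} (hM : M.PosDef) (p : Price L)
    {q x : Bundle L} (hqx : q.1 ≠ x.1) (hc : cost p x ≤ cost p q) :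
    ∃ d : Fin L → ℝ, 0 < d ⬝ᵥ (M *ᵥ (q.1 - x.1)) ∧ (p.1 ⬝ᵥ d ≤ 0 ∨ 0 ≤ d) ∧
      ∀ᶠ η : ℝ in nhdsWithin 0 (Set.Ioi 0),
        0 ≤ x.1 + η • d ∧ p.1 ⬝ᵥ (x.1 + η • d) ≤ cost p q := by
  have hpos := dotProduct_mulVec_pos hM (sub_ne_zero.2 hqx)
  have hIoc : ∀ᶠ η : ℝ in nhdsWithin 0 (Set.Ioi 0), η ∈ Set.Ioc (0 : ℝ) 1 :=
    Ioc_mem_nhdsGT one_pos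
  rcases hc.eq_or_lt with heq | hlt
  · have h0 : p.1 ⬝ᵥ (q.1 - x.1) = 0 := by
      rw [dotProduct_sub]
      exact sub_eq_zero.2 heq.symm
    refine ⟨q.1 - x.1, hpos, Or.inl h0.le, hIoc.mono fun η hη => ⟨fun i => ?_, ?_⟩⟩
    · have h1 := q.2 i
      have h2 := x.2 i
      simp only [Pi.zero_apply, Pi.add_apply, Pi.smul_apply, Pi.sub_apply, smul_eq_mul] at *
      nlinarith [mul_nonneg hη.1.le h1, mul_nonneg (sub_nonneg.2 hη.2) h2]
    · rw [dotProduct_add, dotProduct_smul, h0, smul_zero, add_zero]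
      exact hc
  · obtain ⟨i, -, hi⟩ := Finset.exists_lt_of_sum_lt (s := Finset.univ) (f := fun _ => (0 : ℝ))
      (g := fun i => (q.1 - x.1) i * (M *ᵥ (q.1 - x.1)) i) (by rw [Finset.sum_const_zero]; exact hpos)
    refine ⟨Pi.single i ((q.1 - x.1) i), by rwa [single_dotProduct], ?_, ?_⟩
    · rcases le_total 0 ((q.1 - x.1) i) with h | h
      · exact Or.inr (Pi.single_nonneg.2 h)
      · left
        rw [dotProduct_single]
        exact mul_nonpos_of_nonneg_of_nonpos (p.2 i).le h
    · have hcont : Continuous fun η : ℝ =>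
          p.1 ⬝ᵥ (x.1 + η • (Pi.single i ((q.1 - x.1) i) : Fin L → ℝ)) := by fun_prop
      have hev := (hcont.tendsto 0).eventually_lt_const
        (show p.1 ⬝ᵥ (x.1 + (0 : ℝ) • (Pi.single i ((q.1 - x.1) i) : Fin L → ℝ)) < cost p q by
          rw [zero_smul, add_zero]; exact hlt)
      filter_upwards [hIoc, nhdsWithin_le_nhds hev] with η hη hη'
      refine ⟨fun j => ?_, hη'.le⟩
      have h1 := q.2 j
      have h2 := x.2 j
      by_cases hj : j = i
      · subst hj
        simp only [Pi.zero_apply, Pi.add_apply, Pi.smul_apply, Pi.sub_apply, smul_eq_mul,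
          Pi.single_eq_same] at *
        nlinarith [mul_nonneg hη.1.le h1, mul_nonneg (sub_nonneg.2 hη.2) h2]
      · simpa [Pi.single_eq_of_ne hj] using h2

lemma eventually_dotProduct_mulVec_lt {M : Matrix (Fin L) (Fin L) ℝ} (hM : M.PosDef)
    {w d : Fin L → ℝ} (h : 0 < d ⬝ᵥ (M *ᵥ w)) :
    ∀ᶠ η : ℝ in nhdsWithin 0 (Set.Ioi 0),
      (w - η • d) ⬝ᵥ (M *ᵥ (w - η • d)) < w ⬝ᵥ (M *ᵥ w) := by
  have hsymm : w ⬝ᵥ (M *ᵥ d) = d ⬝ᵥ (M *ᵥ w) := by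
    have hT : Mᵀ = M := by simpa using hM.isHermitian.eq
    rw [Matrix.dotProduct_mulVec, ← Matrix.mulVec_transpose, hT, dotProduct_comm]
  have hcont : Continuous fun η : ℝ => η * (d ⬝ᵥ (M *ᵥ d)) := by fun_prop
  have hev := (hcont.tendsto 0).eventually_lt_const
    (show 0 * (d ⬝ᵥ (M *ᵥ d)) < 2 * (d ⬝ᵥ (M *ᵥ w)) by linarith)
  filter_upwards [nhdsWithin_le_nhds hev, self_mem_nhdsWithin] with η h1 h2
  have h3 : (w - η • d) ⬝ᵥ (M *ᵥ (w - η • d)) = w ⬝ᵥ (M *ᵥ w) -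
      η * (2 * (d ⬝ᵥ (M *ᵥ w)) - η * (d ⬝ᵥ (M *ᵥ d))) := by
    simp only [Matrix.mulVec_sub, Matrix.mulVec_smul, sub_dotProduct, dotProduct_sub,
      smul_dotProduct, dotProduct_smul, smul_eq_mul, hsymm]
    ring
  rw [h3]
  have := mul_pos (Set.mem_Ioi.1 h2) (sub_pos.2 h1)
  linarith

/-- Distinct small weights for which a chosen observation is smallest or largest. -/
lemma exists_weights (t : Fin T) (c m : Fin T → ℝ) (hm : ∀ s, 0 < m s) {P Q : Prop} (h : P ∨ Q) :
    ∃ κ : Fin T → ℝ, (∀ s, 0 < κ s) ∧ (∀ s, κ s * c s ≤ m s) ∧ Function.Injective κ ∧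
      (P ∨ ∀ s, κ s ≤ κ t) ∧ (Q ∨ ∀ s, κ t ≤ κ s) := by
  obtain ⟨k, hk0, hk, hkP, hkQ⟩ : ∃ k : Fin T → ℝ, (∀ s, 0 < k s) ∧ Function.Injective k ∧
      (P ∨ ∀ s, k s ≤ k t) ∧ (Q ∨ ∀ s, k t ≤ k s) := by
    have hinj : ∀ a : ℕ, (∀ s : Fin T, a ≠ s + 1) →
        Function.Injective fun s : Fin T => ((if s = t then a else s + 1 : ℕ) : ℝ) := by
      intro a ha s s' hss
      have h1 : (if s = t then a else s + 1 : ℕ) = if s' = t then a else s' + 1 :=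
        Nat.cast_injective hss
      have h2 := ha s
      have h3 := ha s'
      split_ifs at h1 with h4 h5 h5
      · exact h4.trans h5.symm
      · omega
      · omega
      · exact Fin.ext (by omega)
    rcases h with h | h
    · refine ⟨fun s => ((if s = t then 0 else s + 1 : ℕ) : ℝ) + 1, fun s => by positivity,
        fun s s' hss => hinj 0 (fun s => by omega) (add_left_injective 1 hss), Or.inl h,
        Or.inr fun s => ?_⟩
      simpa using (Nat.cast_nonneg (α := ℝ) (if s = t then 0 else s + 1 : ℕ))
    · refine ⟨fun s => ((if s = t then T + 1 else s + 1 : ℕ) : ℝ) + 1, fun s => by positivity,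
        fun s s' hss => hinj (T + 1) (fun s => by omega) (add_left_injective 1 hss),
        Or.inr fun s => ?_, Or.inl h⟩
      have : (if s = t then T + 1 else s + 1 : ℕ) ≤ T + 1 := by split_ifs <;> omega
      simpa using (by exact_mod_cast this : ((if s = t then T + 1 else s + 1 : ℕ) : ℝ) ≤ T + 1)
  have hev : ∀ᶠ a : ℝ in nhdsWithin 0 (Set.Ioi 0), ∀ s, a * k s * c s ≤ m s := by
    refine Filter.eventually_all.2 fun s => nhdsWithin_le_nhds ?_
    have hcont : Continuous fun a : ℝ => a * k s * c s := by fun_prop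
    exact ((hcont.tendsto 0).eventually_lt_const (by simpa using hm s)).mono fun _ => le_of_lt
  obtain ⟨a, ha, ha0 : 0 < a⟩ := (hev.and self_mem_nhdsWithin).exists
  exact ⟨fun s => a * k s, fun s => mul_pos ha0 (hk0 s), ha,
    fun s s' hss => hk (mul_left_cancel₀ ha0.ne' hss),
    hkP.imp_right fun h s => mul_le_mul_of_nonneg_left (h s) ha0.le,
    hkQ.imp_right fun h s => mul_le_mul_of_nonneg_left (h s) ha0.le⟩

/-- From a closest optimal tuple `x`, one step along a descent direction gives `X`, and mixing in
small multiples of the all-ones bundle gives `Y`. The ranking by `(U (x s), κ s)` is compatible with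
the revealed preferences of `Y`. -/
theorem exists_lsLoss_lt (hW : ∀ T, IsLSWeight (W T)) (hU : U ∈ wellBehaved L) {D : Dataset L T}
    (hD : ¬ Rationalizes U D) :
    ∃ U' ∈ wellBehaved L, lsLoss W T U' D < lsLoss W T U D := by
  classical
  obtain ⟨x, hx, hle⟩ := exists_squaredLoss_le_lsLoss (W := W) hU D
  have hM := (hW T).posDef D
  have hcost : ∀ s s', cost (D.price s) (x s') ≤ cost (D.price s) (x s) → U (x s') ≤ U (x s) := by
    intro s s' h
    rcases (cost_nonneg (D.price s) (x s)).eq_or_lt with h0 | h0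
    · rw [eq_zero_of_cost_nonpos _ h0.ge, eq_zero_of_cost_nonpos _ (h.trans h0.ge)]
    · exact apply_le_of_cost_le hU.1 h0 (hx s).2 h
  have hcost' : ∀ s s', cost (D.price s) (x s') < cost (D.price s) (x s) → U (x s') < U (x s) :=
    fun s s' h => have := D.nonempty_goods s; apply_lt_of_cost_lt hU (hx s).2 h
  obtain ⟨t, ht⟩ : ∃ t, (D.bundle t).1 ≠ (x t).1 := by
    by_contra! h
    exact hD (rationalizes_of_mem_optimalTuples hU hx h)
  have := D.nonempty_goods t
  obtain ⟨d, hd, hdt, hfeas⟩ := exists_descent_direction (hM t) (D.price t) ht (hx t).1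
  let X : ℝ → Fin T → Fin L → ℝ := fun η =>
    Function.update (fun s => (x s).1) t ((x t).1 + η • d)
  have hXt : ∀ η, X η t = (x t).1 + η • d := fun η => Function.update_self ..
  have hXs : ∀ η s, s ≠ t → X η s = (x s).1 := fun η s hs => Function.update_of_ne hs ..
  have hX0 : X 0 = fun s => (x s).1 := by simp [X]
  have hXc : Continuous X := continuous_const.update t (by fun_prop)
  have hsep : ∀ᶠ η : ℝ in nhdsWithin 0 (Set.Ioi 0), ∀ s s', U (x s) < U (x s') →
      (D.price s).1 ⬝ᵥ X η s < (D.price s).1 ⬝ᵥ X η s' := by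
    refine Filter.eventually_all.2 fun s => Filter.eventually_all.2 fun s' =>
      Filter.eventually_all.2 fun h => nhdsWithin_le_nhds ?_
    refine (isOpen_lt (f := fun η => (D.price s).1 ⬝ᵥ X η s)
      (g := fun η => (D.price s).1 ⬝ᵥ X η s') (by fun_prop) (by fun_prop)).mem_nhds ?_
    rw [Set.mem_ofPred_eq, hX0]
    exact not_le.1 fun h' => (hcost s s' h').not_gt h
  obtain ⟨η, ⟨⟨hη0, hηc⟩, hηs⟩, hηd, hη⟩ := ((hfeas.and hsep).and
    ((eventually_dotProduct_mulVec_lt (hM t) hd).and self_mem_nhdsWithin)).exists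
  have hη : 0 < η := hη
  have hXnn : ∀ s, 0 ≤ X η s := fun s => by
    by_cases hs : s = t
    · rw [hs, hXt]; exact hη0
    · rw [hXs η s hs]; exact (x s).2
  have hXb : ∀ s, (D.price s).1 ⬝ᵥ X η s ≤ D.expenditure s := fun s => by
    by_cases hs : s = t
    · rw [hs, hXt]; exact hηc
    · rw [hXs η s hs]; exact (hx s).1
  have hdecr : squaredLoss (W T D) (fun s => (D.bundle s).1) (X η) <
      squaredLoss (W T D) (fun s => (D.bundle s).1) (fun s => (x s).1) := by
    refine Finset.sum_lt_sum (fun s _ => ?_) ⟨t, Finset.mem_univ t, ?_⟩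
    · by_cases hs : s = t
      · subst hs
        rw [hXt, ← sub_sub]
        exact hηd.le
      · rw [hXs η s hs]
    · rw [hXt, ← sub_sub]
      exact hηd
  obtain ⟨κ, hκ0, hκb, hκinj, hκtop, hκbot⟩ := exists_weights t (fun s => (D.price s).1 ⬝ᵥ 1)
    D.expenditure D.expenditure_pos hdt
  -- If `κ t` is not largest, then `d` does not raise the cost at `t`'s own prices; if it is not
  -- smallest, then `d ≥ 0` and `t`'s bundle gets no cheaper for others. Either way, ties stay
  -- weakly ordered as `κ` requires.
  have htie : ∀ s s', U (x s) = U (x s') → κ s < κ s' →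
      (D.price s).1 ⬝ᵥ X η s ≤ (D.price s).1 ⬝ᵥ X η s' := by
    intro s s' hUs hκs
    have h1 : (D.price s).1 ⬝ᵥ (x s).1 ≤ (D.price s).1 ⬝ᵥ (x s').1 :=
      not_lt.1 fun h => (hcost' s s' h).ne' hUs
    by_cases hs : s = t
    · subst hs
      have hs' : s' ≠ s := fun h => hκs.ne (by rw [h])
      rw [hXt, hXs η s' hs', dotProduct_add, dotProduct_smul, smul_eq_mul]
      have := hκtop.resolve_right fun h => (h s').not_gt hκs
      nlinarith
    · rw [hXs η s hs]
      by_cases hs' : s' = t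
      · subst hs'
        rw [hXt, dotProduct_add, dotProduct_smul, smul_eq_mul]
        have h2 := hκbot.resolve_right fun h => (h s).not_gt hκs
        have := mul_nonneg hη.le (dotProduct_nonneg_of_nonneg (fun i => ((D.price s).2 i).le) h2)
        linarith
      · rwa [hXs η s' hs']
  -- The distinct `κ s` make tied comparisons strict. The added term also makes all bundles nonzero,
  -- and the bound on `κ` keeps them affordable.
  let Y : ℝ → Fin T → Fin L → ℝ := fun δ s => (1 - δ) • X η s + (δ * κ s) • 1
  have hYc : Continuous Y := by
    dsimp only [Y]
    fun_prop
  have hY0 : Y 0 = X η := by simp [Y]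
  have hYcost : ∀ δ s s', (D.price s).1 ⬝ᵥ Y δ s' =
      (1 - δ) * ((D.price s).1 ⬝ᵥ X η s') + δ * κ s' * ((D.price s).1 ⬝ᵥ 1) := fun δ s s' => by
    simp only [Y, dotProduct_add, dotProduct_smul, smul_eq_mul]
  have hYloss : ∀ᶠ δ : ℝ in nhdsWithin 0 (Set.Ioi 0),
      squaredLoss (W T D) (fun s => (D.bundle s).1) (Y δ) < lsLoss W T U D :=
    nhdsWithin_le_nhds ((((continuous_squaredLoss _ _).comp hYc).tendsto 0).eventually_lt_const
      (by simpa only [Function.comp_apply, hY0] using hdecr.trans_le hle))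
  have hYsep : ∀ᶠ δ : ℝ in nhdsWithin 0 (Set.Ioi 0), ∀ s s', U (x s) < U (x s') →
      (D.price s).1 ⬝ᵥ Y δ s < (D.price s).1 ⬝ᵥ Y δ s' := by
    refine Filter.eventually_all.2 fun s => Filter.eventually_all.2 fun s' =>
      Filter.eventually_all.2 fun h => nhdsWithin_le_nhds ?_
    refine (isOpen_lt (f := fun δ => (D.price s).1 ⬝ᵥ Y δ s)
      (g := fun δ => (D.price s).1 ⬝ᵥ Y δ s') (by fun_prop) (by fun_prop)).mem_nhds ?_
    rw [Set.mem_ofPred_eq, hY0]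
    exact hηs s s' h
  obtain ⟨δ, ⟨hδloss, hδsep⟩, hδ0, hδ1⟩ :=
    ((hYloss.and hYsep).and (Ioo_mem_nhdsGT one_pos)).exists
  have hYpos : ∀ s i, 0 < Y δ s i := fun s i => by
    have h1 := mul_nonneg (sub_nonneg.2 hδ1.le) (hXnn s i)
    have h2 := mul_pos hδ0 (hκ0 s)
    simp only [Y, Pi.add_apply, Pi.smul_apply, smul_eq_mul, Pi.one_apply, mul_one]
    exact add_pos_of_nonneg_of_pos h1 h2
  let D' : Dataset L T := fun s => (⟨⟨Y δ s, fun i => (hYpos s i).le⟩,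
    fun h => (hYpos s (Classical.arbitrary _)).ne' (congrFun h _)⟩, D.price s)
  obtain ⟨U', hU', hr⟩ := exists_effRationalizes_of_rank D' (e := fun _ => 1) (fun _ => le_rfl)
    (fun s => toLex (U (x s), κ s)) fun s s' hss' hc => by
      rw [one_mul] at hc
      have hc : (D.price s).1 ⬝ᵥ Y δ s' ≤ (D.price s).1 ⬝ᵥ Y δ s := hc
      by_contra hlt
      rw [Prod.Lex.toLex_lt_toLex] at hlt
      push Not at hlt
      rcases hlt.1.lt_or_eq with h | h
      · exact (hδsep s s' h).not_ge hc
      · have hκs : κ s < κ s' := lt_of_le_of_ne (hlt.2 h.symm) (hκinj.ne hss')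
        have h1 := htie s s' h hκs
        rw [hYcost, hYcost] at hc
        have h2 : 0 < (D.price s).1 ⬝ᵥ (1 : Fin L → ℝ) := by
          rw [dotProduct_one]
          exact Finset.sum_pos (fun i _ => (D.price s).2 i) Finset.univ_nonempty
        have h3 := mul_pos (mul_pos hδ0 (sub_pos.2 hκs)) h2
        have h4 := mul_le_mul_of_nonneg_left h1 (sub_nonneg.2 hδ1.le)
        linarith
  refine ⟨U', hU', (lsLoss_le hW (D := D) (D' := D') (fun _ => rfl) (rationalizes_iff_eff_one.2 hr)
    fun s => ?_).trans_lt hδloss⟩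
  show (D.price s).1 ⬝ᵥ Y δ s ≤ _
  rw [hYcost]
  have h1 := mul_le_mul_of_nonneg_left (hXb s) (sub_nonneg.2 hδ1.le)
  have h2 := mul_le_mul_of_nonneg_left (hκb s) hδ0.le
  linarith

end LeastSquares

/-! ### Violations of GARP and conclusion -/

lemma two_le_of_not_garp {D : Dataset L T} (hD : ¬ GARP D) : 2 ≤ L := by
  by_contra hL
  refine hD (Rationalizes.garp (U := fun q => ∑ i, q.1 i) ⟨?_, fun q q' h => ?_⟩
    fun t q hq => ?_)
  · exact continuous_finsetSum _ fun i _ => (continuous_apply i).comp continuous_subtype_val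
  · obtain ⟨hle, i, hi⟩ := Pi.lt_def.1 (show q.1 < q'.1 from h)
    exact Finset.sum_lt_sum (fun j _ => hle j) ⟨i, Finset.mem_univ i, hi⟩
  · have : Subsingleton (Fin L) := Fin.subsingleton_iff_le_one.2 (by omega)
    refine Finset.sum_le_sum fun i _ => not_lt.1 fun hi => ?_
    have hlt : D.bundle t < q :=
      show (D.bundle t).1 < q.1 from
        Pi.lt_def.2 ⟨fun j => by rw [Subsingleton.elim j i]; exact hi.le, i, hi⟩
    exact (cost_strictMono (D.price t) hlt).not_ge hq

lemma exists_not_garp (hL : 2 ≤ L) : ∃ D : Dataset L 2, ¬ GARP D := by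
  let ι : Fin 2 → Fin L := Fin.castLE hL
  have hι : Function.Injective ι := Fin.castLE_injective hL
  -- Each observation buys one unit of its own good at price 2 while the other's good costs 1, so
  -- each bundle is strictly preferred to the other.
  let D : Dataset L 2 := fun t =>
    (⟨⟨Pi.single (ι t) 1, Pi.single_nonneg.2 zero_le_one⟩,
      fun h => one_ne_zero (α := ℝ) (by simpa using congrFun h (ι t))⟩,
      ⟨1 + Pi.single (ι t) 1, fun i => add_pos_of_pos_of_nonneg one_pos
        ((Pi.single_nonneg.2 zero_le_one : (0 : Fin L → ℝ) ≤ Pi.single (ι t) 1) i)⟩)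
  have h : ∀ s t, s ≠ t → StrictRP D s t := fun s t hst => by
    have hne : ι t ≠ ι s := hι.ne hst.symm
    simp [StrictRP, Dataset.expenditure, cost, Dataset.price, Dataset.bundle, D, hne]
  exact ⟨D, fun hG => hG 0 1 (.single (h 0 1 (by decide)).le) (h 1 0 (by decide))⟩

lemma argmin_eq_empty {Q : Loss L} {D : Dataset L T} (hD : ¬ GARP D)
    (hQ : ∀ U ∈ wellBehaved L, ¬ Rationalizes U D → ∃ U' ∈ wellBehaved L, Q T U' D < Q T U D) :
    argmin (wellBehaved L) Q D = ∅ := by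
  refine Set.eq_empty_of_forall_notMem fun U ⟨hU, hmin⟩ => ?_
  obtain ⟨U', hU', hlt⟩ := hQ U hU fun h => hD (h.garp hU)
  exact (hmin U' hU').not_gt hlt

end RevealedPreference

open RevealedPreference in
theorem proposition10 (L : ℕ)
    (f : ∀ T : ℕ, (Fin T → unitInterval) → ℝ)
    (hf : ∀ T : ℕ, IsVarianAggregator (f T))
    (W : ∀ T : ℕ, Dataset L T → Fin T → Matrix (Fin L) (Fin L) ℝ)
    (hW : ∀ T : ℕ, IsLSWeight (W T)) :
    (Accurate (wellBehaved L) (afriatLoss L) ∧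
      Accurate (wellBehaved L) (varianLoss f) ∧
      Accurate (wellBehaved L) (swapsLoss L) ∧
      Accurate (wellBehaved L) (lsLoss W)) ∧
    (2 ≤ L →
      ¬ Minimizable (wellBehaved L) (afriatLoss L) ∧
      ¬ Minimizable (wellBehaved L) (varianLoss f) ∧
      ¬ Minimizable (wellBehaved L) (swapsLoss L) ∧
      ¬ Minimizable (wellBehaved L) (lsLoss W)) ∧
    (∀ (T : ℕ) (D : Dataset L T), ¬ GARP D →
      argmin (wellBehaved L) (varianLoss f) D = ∅ ∧
      argmin (wellBehaved L) (swapsLoss L) D = ∅ ∧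
      argmin (wellBehaved L) (lsLoss W) D = ∅) ∧
    (∀ T : ℕ, IsNowhereDense
      {D : {D : Dataset L T // ¬ GARP D} |
        (argmin (wellBehaved L) (afriatLoss L) D.1).Nonempty}) := by
  have hV : ∀ (T : ℕ) (D : Dataset L T), ¬ GARP D →
      argmin (wellBehaved L) (varianLoss f) D = ∅ := fun T D hD =>
    argmin_eq_empty hD fun U hU => exists_varianLoss_lt hf hU
  have hS : ∀ (T : ℕ) (D : Dataset L T), ¬ GARP D →
      argmin (wellBehaved L) (swapsLoss L) D = ∅ := fun T D hD =>
    argmin_eq_empty hD fun U hU => exists_swapsLoss_lt (two_le_of_not_garp hD) hU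
  have hLS : ∀ (T : ℕ) (D : Dataset L T), ¬ GARP D →
      argmin (wellBehaved L) (lsLoss W) D = ∅ := fun T D hD =>
    argmin_eq_empty hD fun U hU => exists_lsLoss_lt hW hU
  refine ⟨⟨accurate_afriatLoss, accurate_varianLoss hf, accurate_swapsLoss, accurate_lsLoss hW⟩,
    fun hL => ?_, fun T D hD => ⟨hV T D hD, hS T D hD, hLS T D hD⟩,
    fun T => isNowhereDense_argmin_afriatLoss⟩
  obtain ⟨D, hD⟩ := exists_not_garp hL
  refine ⟨fun h => ?_, fun h => (h 2 D).ne_empty (hV 2 D hD),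
    fun h => (h 2 D).ne_empty (hS 2 D hD), fun h => (h 2 D).ne_empty (hLS 2 D hD)⟩
  -- The violating `D` may fail to be generic, so a generic perturbation serves for the Afriat loss.
  obtain ⟨D', -, hev⟩ := exists_tendsto_generic hD
  obtain ⟨ε, hε, hgen⟩ := hev.exists
  exact (h 2 (D' ε)).ne_empty (argmin_afriatLoss_eq_empty hε hgen)
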